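/- Let $P_+$ be the group, under composition, of all orientation-preserving homeomorphisms $f$ of $\mathbb{R}$ that map $\mathbb{Z}[1/2]$ bijectively onto itself and are piecewise linear, with all slopes integral powers of $2$ and all breakpoints dyadic rationals (elements of $\mathbb{Z}[1/2]$); infinitely many breakpoints are allowed, but only finitely many in each bounded interval. For each integer $p\ge 1$ let $$H_p=\{f\in P_+ \mid f(t+p)=f(t)+p \text{ for all } t\in\mathbb{R}\}.$$ Then the group $$H=\bigcup_{p=1}^{\infty}H_p$$ is simple. -/

import Mathlib

open Topology

namespace DyadicPL

/-- The set `ℤ[1/2]` of dyadic rationals, inside `ℝ`. -/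
def dyadic : Set ℝ := {x | ∃ (m : ℤ) (n : ℕ), x = (m : ℝ) / 2 ^ n}

/-- Near `x`, the map `f` is affine, with slope plus or minus an integral power of `2`. -/
def AffineNear (f : ℝ → ℝ) (x : ℝ) : Prop :=
  ∃ (k : ℤ) (a b : ℝ), |a| = (2 : ℝ) ^ k ∧ ∀ᶠ t in 𝓝 x, f t = a * t + b

/-- `f` is a dyadic piecewise linear map: it restricts to a bijection of the dyadic rationals,
and it is locally affine, with slopes plus or minus powers of `2`, away from a set `B` of dyadic
rationals (the possible breakpoints) that has only finitely many points in each compact set. -/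
def IsDyadicPL (f : ℝ ≃ₜ ℝ) : Prop :=
  (∀ x, f x ∈ dyadic ↔ x ∈ dyadic) ∧
  ∃ B : Set ℝ, B ⊆ dyadic ∧ (∀ K : Set ℝ, IsCompact K → (B ∩ K).Finite) ∧
    ∀ x, x ∉ B → AffineNear f x

theorem isDyadicPL_one : IsDyadicPL 1 :=
  ⟨fun _ => Iff.rfl, ∅, Set.empty_subset _, fun K _ => by simp, fun x _ =>
    ⟨0, 1, 0, by simp, Filter.Eventually.of_forall fun t => by simp⟩⟩

theorem IsDyadicPL.mul {f g : ℝ ≃ₜ ℝ} (hf : IsDyadicPL f) (hg : IsDyadicPL g) :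
    IsDyadicPL (f * g) := by
  obtain ⟨hfd, B, hBd, hBf, hB⟩ := hf
  obtain ⟨hgd, C, hCd, hCf, hC⟩ := hg
  refine ⟨fun x => (hfd (g x)).trans (hgd x), C ∪ g ⁻¹' B, ?_, ?_, ?_⟩
  · rintro x (hx | hx)
    · exact hCd hx
    · exact (hgd x).1 (hBd hx)
  · intro K hK
    rw [Set.union_inter_distrib_right]
    refine (hCf K hK).union ?_
    have h1 := hBf (g '' K) (hK.image g.continuous)
    refine (h1.preimage (g.injective.injOn)).subset ?_
    rintro x ⟨hx, hxK⟩
    exact ⟨hx, x, hxK, rfl⟩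
  · intro x hx
    rw [Set.mem_union, not_or] at hx
    obtain ⟨k, a, b, hk, hab⟩ := hC x hx.1
    obtain ⟨l, c, d, hl, hcd⟩ := hB (g x) hx.2
    refine ⟨l + k, c * a, c * b + d, ?_, ?_⟩
    · rw [abs_mul, hk, hl, zpow_add₀ (by norm_num)]
    · filter_upwards [hab, g.continuous.continuousAt.eventually hcd] with t h1 h2
      change f (g t) = _
      rw [h2, h1]
      ring

theorem IsDyadicPL.inv {f : ℝ ≃ₜ ℝ} (hf : IsDyadicPL f) : IsDyadicPL f⁻¹ := by
  obtain ⟨hfd, B, hBd, hBf, hB⟩ := hf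
  have hfi : ∀ y, f (f⁻¹ y) = y := fun y => f.apply_symm_apply y
  refine ⟨fun y => ?_, f.symm ⁻¹' B, ?_, ?_, ?_⟩
  · rw [← hfd, hfi]
  · intro y hy
    have := (hfd _).2 (hBd hy)
    rwa [f.apply_symm_apply] at this
  · intro K hK
    have h1 := hBf (f.symm '' K) (hK.image f.symm.continuous)
    refine (h1.preimage (f.symm.injective.injOn)).subset ?_
    rintro x ⟨hx, hxK⟩
    exact ⟨hx, x, hxK, rfl⟩
  · intro y hy
    obtain ⟨k, a, b, hk, hab⟩ := hB (f.symm y) hy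
    have ha : a ≠ 0 := by
      rintro rfl
      have : (0 : ℝ) < 2 ^ k := by positivity
      simp at hk
      linarith
    refine ⟨-k, a⁻¹, -(a⁻¹ * b), by rw [abs_inv, hk, zpow_neg], ?_⟩
    filter_upwards [f.symm.continuous.continuousAt.eventually hab] with t ht
    rw [f.apply_symm_apply] at ht
    change f.symm t = _
    field_simp
    linarith

/-- The group `P` of dyadic piecewise linear homeomorphisms of the real line, under
composition. -/
def P : Subgroup (ℝ ≃ₜ ℝ) where
  carrier := {f | IsDyadicPL f}
  mul_mem' := IsDyadicPL.mul
  one_mem' := isDyadicPL_one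
  inv_mem' := IsDyadicPL.inv

/-- The subgroup `P₊` of the orientation-preserving elements of `P`. -/
def PPlus : Subgroup (ℝ ≃ₜ ℝ) where
  carrier := {f | f ∈ P ∧ StrictMono f}
  mul_mem' := fun hf hg => ⟨P.mul_mem hf.1 hg.1, hf.2.comp hg.2⟩
  one_mem' := ⟨P.one_mem, strictMono_id⟩
  inv_mem' := by
    intro f hf
    refine ⟨P.inv_mem hf.1, fun x y hxy => ?_⟩
    have hfi : ∀ y, f (f⁻¹ y) = y := fun y => f.apply_symm_apply y
    rw [← hf.2.lt_iff_lt, hfi, hfi]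
    exact hxy

/-- The group `H_p` of `p`-periodically affine elements of `P₊`. -/
def Hp (p : ℕ) : Subgroup (ℝ ≃ₜ ℝ) where
  carrier := {f | f ∈ PPlus ∧ ∀ t : ℝ, f (t + p) = f t + p}
  mul_mem' := by
    rintro f g ⟨hf, hf'⟩ ⟨hg, hg'⟩
    refine ⟨PPlus.mul_mem hf hg, fun t => ?_⟩
    change f (g (t + p)) = f (g t) + p
    rw [hg', hf']
  one_mem' := ⟨PPlus.one_mem, fun _ => rfl⟩
  inv_mem' := by
    rintro f ⟨hf, hf'⟩
    refine ⟨PPlus.inv_mem hf, fun t => ?_⟩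
    have hfi : ∀ y, f (f⁻¹ y) = y := fun y => f.apply_symm_apply y
    apply f.injective
    rw [hf', hfi, hfi]

theorem Hp_le_mul (p q : ℕ) : Hp p ≤ Hp (p * q) := by
  rintro f ⟨hf, hf'⟩
  refine ⟨hf, fun t => ?_⟩
  induction q with
  | zero => simp
  | succ n ih =>
    have h : t + ((p * (n + 1) : ℕ) : ℝ) = (t + ((p * n : ℕ) : ℝ)) + p := by
      push_cast
      ring
    rw [h, hf', ih]
    push_cast
    ring

/-- The group `H`, the union of the groups `H_p` over all integers `p ≥ 1`. -/
def H : Subgroup (ℝ ≃ₜ ℝ) where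
  carrier := {f | ∃ p : ℕ, 1 ≤ p ∧ f ∈ Hp p}
  mul_mem' := by
    rintro f g ⟨p, hp, hf⟩ ⟨q, hq, hg⟩
    refine ⟨p * q, Nat.mul_pos hp hq, (Hp (p * q)).mul_mem (Hp_le_mul p q hf) ?_⟩
    rw [mul_comm]
    exact Hp_le_mul q p hg
  one_mem' := ⟨1, le_rfl, (Hp 1).one_mem⟩
  inv_mem' := by
    rintro f ⟨p, hp, hf⟩
    exact ⟨p, hp, (Hp p).inv_mem hf⟩

end DyadicPL

namespace DyadicPL

/-! Let `N` be a nontrivial normal subgroup of `H`. Dyadic translations lie in `H`, so conjugation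
yields some `f` in `N` with `f 0 ≠ 0`. Pass to a period `q` common to `f` and a given `g`, and large
compared with `f 0` and `g 0`.

Commutators. If `a` and `b` in `H_q` move only points very near `qℤ`, then `f * a⁻¹ * f⁻¹` moves
only points near `f 0 + qℤ`, so it commutes with `b`. Hence `[a, b] = [[a, f], b]` lies in `N`
(`exists_commuteNear`).

Bumps. The basic elements are `q`-periodic copies of Thompson-like maps, the rescaled ramps. Four
explicit relations between bumps supported near `qℤ` become, once these bumps commute modulo `N`,
equations that force the bumps to be trivial modulo `N` (`bump_base_mem`). Conjugation by
translations and a factorization of long bumps then put every bump of fine scale into `N`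
(`bump_mem`).

Generation. An element of `H_q` fixing `0` maps each cell of a fine enough dyadic grid affinely onto
a standard dyadic interval (`eventually_adaptedGrid`). Its images of the cells of `[0, q]` form a
dyadic subdivision. Composing with a bump or its inverse merges two sibling intervals and halves a
large one; this lowers the number of contracted cells (`exists_move`) until the subdivision is
uniform and the element is the identity. So `N` contains the stabilizer of `0` in `H_q`. A power of
a bump carries `0` to any prescribed dyadic value that is positive and at most `q - 2`, which
handles all remaining elements after a possible inversion. -/

/-! ### Dyadic arithmetic and membership in `H_p` -/

theorem dyadic_add {x y : ℝ} (hx : x ∈ dyadic) (hy : y ∈ dyadic) : x + y ∈ dyadic := by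
  obtain ⟨a, m, rfl⟩ := hx
  obtain ⟨b, n, rfl⟩ := hy
  refine ⟨a * 2 ^ n + b * 2 ^ m, m + n, ?_⟩
  push_cast
  rw [pow_add]
  field_simp

theorem dyadic_neg {x : ℝ} (hx : x ∈ dyadic) : -x ∈ dyadic := by
  obtain ⟨a, m, rfl⟩ := hx
  exact ⟨-a, m, by push_cast; ring⟩

theorem dyadic_mul {x y : ℝ} (hx : x ∈ dyadic) (hy : y ∈ dyadic) : x * y ∈ dyadic := by
  obtain ⟨a, m, rfl⟩ := hx
  obtain ⟨b, n, rfl⟩ := hy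
  refine ⟨a * b, m + n, ?_⟩
  push_cast
  rw [pow_add]
  field_simp

theorem dyadic_intCast (a : ℤ) : (a : ℝ) ∈ dyadic := ⟨a, 0, by simp⟩

theorem dyadic_zpow (k : ℤ) : (2 : ℝ) ^ k ∈ dyadic := by
  obtain ⟨n, rfl | rfl⟩ := k.eq_nat_or_neg
  · exact ⟨2 ^ n, 0, by simp⟩
  · exact ⟨1, n, by simp⟩

theorem dyadic_int_div_pow (a : ℤ) (n : ℕ) : (a : ℝ) / 2 ^ n ∈ dyadic := ⟨a, n, rfl⟩

theorem affine_mem_dyadic_iff (k : ℤ) {b x : ℝ} (hb : b ∈ dyadic) :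
    2 ^ k * x + b ∈ dyadic ↔ x ∈ dyadic := by
  refine ⟨fun h => ?_, fun h => dyadic_add (dyadic_mul (dyadic_zpow k) h) hb⟩
  have := dyadic_mul (dyadic_zpow (-k)) (dyadic_add h (dyadic_neg hb))
  rwa [add_neg_cancel_right, ← mul_assoc, ← zpow_add₀ (by norm_num), neg_add_cancel, zpow_zero,
    one_mul] at this

/-- An increasing periodic homeomorphism which is affine on the cells of a dyadic grid, with
slopes powers of `2` and dyadic constant terms, lies in `H_p`. -/
theorem mem_Hp_of_grid {F : ℝ ≃ₜ ℝ} (hF : StrictMono F) {p : ℕ} (n : ℕ)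
    (hper : ∀ t : ℝ, F (t + p) = F t + p)
    (hgrid : ∀ j : ℤ, ∃ (k : ℤ) (b : ℝ), b ∈ dyadic ∧
      ∀ t : ℝ, (j : ℝ) ≤ t * 2 ^ n → t * 2 ^ n ≤ j + 1 → F t = 2 ^ k * t + b) :
    F ∈ Hp p := by
  refine ⟨⟨⟨fun x => ?_, Set.range fun j : ℤ => (j : ℝ) / 2 ^ n, ?_, ?_, ?_⟩, hF⟩, hper⟩
  · obtain ⟨k, b, hb, h⟩ := hgrid ⌊x * 2 ^ n⌋
    rw [h x (Int.floor_le _) (Int.lt_floor_add_one _).le, affine_mem_dyadic_iff k hb]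
  · rintro _ ⟨j, rfl⟩
    exact dyadic_int_div_pow j n
  · intro K hK
    obtain ⟨R, hR⟩ := hK.isBounded.subset_closedBall 0
    refine ((Set.finite_Icc (-⌈R * 2 ^ n⌉) ⌈R * 2 ^ n⌉).image
      fun j : ℤ => (j : ℝ) / 2 ^ n).subset ?_
    rintro _ ⟨⟨j, rfl⟩, hj⟩
    have h1 := hR hj
    rw [mem_closedBall_zero_iff, Real.norm_eq_abs, abs_div, abs_of_pos (by positivity : (0 : ℝ) < 2 ^ n),
      div_le_iff₀ (by positivity)] at h1
    have h2 := abs_le.1 (h1.trans (Int.le_ceil _))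
    exact ⟨j, ⟨by exact_mod_cast h2.1, by exact_mod_cast h2.2⟩, rfl⟩
  · intro x hx
    obtain ⟨k, b, hb, h⟩ := hgrid ⌊x * 2 ^ n⌋
    refine ⟨k, 2 ^ k, b, abs_of_pos (by positivity), ?_⟩
    have h1 : (⌊x * 2 ^ n⌋ : ℝ) < x * 2 ^ n := by
      refine lt_of_le_of_ne (Int.floor_le _) fun h' => hx ⟨⌊x * 2 ^ n⌋, ?_⟩
      simp only [h']
      field_simp
    have h2 : x * 2 ^ n < ⌊x * 2 ^ n⌋ + 1 := Int.lt_floor_add_one _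
    have hc : ContinuousAt (fun t : ℝ => t * 2 ^ n) x := by fun_prop
    filter_upwards [hc.eventually (lt_mem_nhds h1), hc.eventually (gt_mem_nhds h2)] with t ht1 ht2
    exact h t ht1.le ht2.le

theorem Hp_le_H {p : ℕ} (hp : 1 ≤ p) : Hp p ≤ H := fun _ hf => ⟨p, hp, hf⟩

theorem Hp.apply_add_int_mul {p : ℕ} {f : ℝ ≃ₜ ℝ} (hf : f ∈ Hp p) (t : ℝ) (k : ℤ) :
    f (t + k * p) = f t + k * p := by
  induction k with
  | zero => simp
  | succ k ih =>
    have : t + ((k : ℤ) + 1 : ℤ) * (p : ℝ) = t + (k : ℤ) * p + p := by push_cast; ring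
    rw [this, hf.2, ih]
    push_cast
    ring
  | pred k ih =>
    have := hf.2 (t + ((-k - 1 : ℤ) : ℝ) * p)
    have h2 : t + ((-k - 1 : ℤ) : ℝ) * (p : ℝ) + p = t + ((-k : ℤ) : ℝ) * p := by push_cast; ring
    rw [h2, ih] at this
    push_cast at this ⊢
    linarith

/-- Elements of `H_p` are determined by their values on one period. -/
theorem Hp.ext {p : ℕ} (hp : 1 ≤ p) {f g : ℝ ≃ₜ ℝ} (hf : f ∈ Hp p) (hg : g ∈ Hp p) (a : ℝ)
    (h : ∀ t, a ≤ t → t ≤ a + p → f t = g t) : f = g := by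
  ext t
  have hp' : (0 : ℝ) < p := by exact_mod_cast hp
  have h1 := Int.floor_le ((t - a) / p)
  have h2 := (Int.lt_floor_add_one ((t - a) / p)).le
  rw [le_div_iff₀ hp'] at h1
  rw [div_le_iff₀ hp'] at h2
  have h3 : t = t - ⌊(t - a) / p⌋ * p + ⌊(t - a) / p⌋ * p := by ring
  rw [h3, Hp.apply_add_int_mul hf, Hp.apply_add_int_mul hg, h _ (by linarith) (by linarith)]

/-- Translation by `r`. -/
noncomputable def shift (r : ℝ) : ℝ ≃ₜ ℝ := Homeomorph.addRight r

@[simp] theorem shift_apply (r t : ℝ) : shift r t = t + r := rfl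

@[simp] theorem shift_inv_apply (r t : ℝ) : (shift r)⁻¹ t = t - r := by
  change t + -r = t - r
  ring

theorem shift_mem_Hp {r : ℝ} (hr : r ∈ dyadic) (p : ℕ) : shift r ∈ Hp p := by
  refine mem_Hp_of_grid (fun x y h => by simpa using h) 0 (fun t => by simp; ring)
    fun j => ⟨0, r, hr, fun t _ _ => by simp⟩

/-! ### Ramps and their periodic copies, the bumps -/

/-- The increasing map with slope `2` on `[0, 1]`, slope `1` on `[1, m + 1]`, slope `1 / 2` on
`[m + 1, m + 3]`, and equal to the identity elsewhere. -/
noncomputable def ramp (m : ℕ) (s : ℝ) : ℝ := max s (min (min (2 * s) (s + 1)) ((s + m + 3) / 2))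

theorem ramp_of_nonpos (m : ℕ) {s : ℝ} (h : s ≤ 0) : ramp m s = s := by
  unfold ramp
  refine max_eq_left ((min_le_left _ _).trans ((min_le_left _ _).trans (by linarith)))

theorem ramp_of_le_one (m : ℕ) {s : ℝ} (h : 0 ≤ s) (h1 : s ≤ 1) : ramp m s = 2 * s := by
  have : (0 : ℝ) ≤ m := by positivity
  unfold ramp
  rw [min_eq_left (by linarith : 2 * s ≤ s + 1), min_eq_left (by linarith),
    max_eq_right (by linarith)]

theorem ramp_of_mid (m : ℕ) {s : ℝ} (h : 1 ≤ s) (h1 : s ≤ m + 1) : ramp m s = s + 1 := by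
  unfold ramp
  rw [min_eq_right (by linarith : s + 1 ≤ 2 * s), min_eq_left (by linarith),
    max_eq_right (by linarith)]

theorem ramp_of_end (m : ℕ) {s : ℝ} (h : m + 1 ≤ s) (h1 : s ≤ m + 3) :
    ramp m s = (s + m + 3) / 2 := by
  have : (0 : ℝ) ≤ m := by positivity
  unfold ramp
  rw [min_eq_right (by linarith : s + 1 ≤ 2 * s), min_eq_right (by linarith),
    max_eq_right (by linarith)]

theorem ramp_of_ge (m : ℕ) {s : ℝ} (h : m + 3 ≤ s) : ramp m s = s := by
  unfold ramp
  exact max_eq_left ((min_le_right _ _).trans (by linarith))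

theorem ramp_strictMono (m : ℕ) : StrictMono (ramp m) := fun s t h => by
  refine max_lt_max h (min_lt_min (min_lt_min ?_ ?_) ?_) <;> linarith

/-- `ramp m` as an order isomorphism. -/
noncomputable def rampIso (m : ℕ) : ℝ ≃o ℝ :=
  (ramp_strictMono m).orderIsoOfRightInverse _
    -- The inverse takes the inverses of the affine pieces, with `max` and `min` interchanged.
    (fun t => min t (max (max (t / 2) (t - 1)) (2 * t - m - 3))) fun t => by
      have hm : (0 : ℝ) ≤ m := by positivity
      unfold ramp
      grind

/-- The extension, commuting with translation by `Q`, of the restriction to `[0, Q]` of an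
increasing bijection that fixes `0` and `Q`. -/
noncomputable def periodize (b : ℝ ≃o ℝ) {Q : ℝ} (hQ : 0 < Q) (h0 : b 0 = 0) (h1 : b Q = Q) :
    ℝ ≃o ℝ :=
  StrictMono.orderIsoOfRightInverse (fun t => b (t - ⌊t / Q⌋ * Q) + ⌊t / Q⌋ * Q)
    (by
      intro s t hst
      have hs := (div_lt_iff₀ hQ).1 (Int.lt_floor_add_one (s / Q))
      have ht := (le_div_iff₀ hQ).1 (Int.floor_le (t / Q))
      have hle : ⌊s / Q⌋ ≤ ⌊t / Q⌋ := Int.floor_le_floor (by gcongr)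
      rcases hle.eq_or_lt with h | h
      · simp only [h]
        gcongr
      · have h2 : b (s - ⌊s / Q⌋ * Q) < Q := by
          conv_rhs => rw [← h1]
          exact b.strictMono (by linarith)
        have h3 : 0 ≤ b (t - ⌊t / Q⌋ * Q) := by
          conv_lhs => rw [← h0]
          exact b.monotone (by linarith)
        have h4 : ((⌊s / Q⌋ : ℝ) + 1) * Q ≤ ⌊t / Q⌋ * Q := by
          gcongr
          exact_mod_cast h
        simp only
        linarith)
    (fun t => b.symm (t - ⌊t / Q⌋ * Q) + ⌊t / Q⌋ * Q)
    (by
      intro t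
      have h2 := (div_lt_iff₀ hQ).1 (Int.lt_floor_add_one (t / Q))
      have h3 := (le_div_iff₀ hQ).1 (Int.floor_le (t / Q))
      have h4 : 0 ≤ b.symm (t - ⌊t / Q⌋ * Q) := by
        rw [b.le_symm_apply, h0]
        linarith
      have h5 : b.symm (t - ⌊t / Q⌋ * Q) < Q := by
        rw [b.symm_apply_lt, h1]
        linarith
      have h6 : ⌊(b.symm (t - ⌊t / Q⌋ * Q) + ⌊t / Q⌋ * Q) / Q⌋ = ⌊t / Q⌋ := by
        rw [Int.floor_eq_iff, le_div_iff₀ hQ, div_lt_iff₀ hQ]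
        constructor <;> linarith
      simp only [h6, add_sub_cancel_right, OrderIso.apply_symm_apply, sub_add_cancel])

theorem periodize_apply (b : ℝ ≃o ℝ) {Q : ℝ} (hQ : 0 < Q) (h0 : b 0 = 0) (h1 : b Q = Q) (k : ℤ)
    {s : ℝ} (hs : 0 ≤ s) (hs' : s ≤ Q) : periodize b hQ h0 h1 (s + k * Q) = b s + k * Q := by
  change b (s + k * Q - ⌊(s + k * Q) / Q⌋ * Q) + ⌊(s + k * Q) / Q⌋ * Q = _
  have h2 : (s + k * Q) / Q = s / Q + k := by field_simp
  rw [h2, Int.floor_add_intCast]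
  rcases hs'.eq_or_lt with rfl | h
  · rw [div_self hQ.ne', Int.floor_one, Int.cast_add, Int.cast_one]
    have : s + k * s - (1 + k) * s = 0 := by ring
    rw [this, h0, h1]
    ring
  · have : ⌊s / Q⌋ = 0 := by
      rw [Int.floor_eq_iff]
      simp only [Int.cast_zero, zero_add]
      exact ⟨by positivity, (div_lt_one hQ).2 h⟩
    rw [this]
    simp

theorem cells_pos {q n m : ℕ} (h : m + 3 ≤ q * 2 ^ n) : (0 : ℝ) < (q * 2 ^ n : ℕ) := by
  exact_mod_cast lt_of_lt_of_le (by omega) h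

theorem rampIso_zero (m : ℕ) : rampIso m 0 = 0 := ramp_of_nonpos m le_rfl

theorem rampIso_cells {q n m : ℕ} (h : m + 3 ≤ q * 2 ^ n) :
    rampIso m (q * 2 ^ n : ℕ) = (q * 2 ^ n : ℕ) := ramp_of_ge m (by exact_mod_cast h)

/-- The `q`-periodic homeomorphism that equals, on `[i / 2 ^ n, i / 2 ^ n + q]`, the map `ramp m`
rescaled by `2 ^ (-n)` and moved to start at `i / 2 ^ n`. -/
noncomputable def bumpHomeo (q n : ℕ) (i : ℤ) (m : ℕ) (h : m + 3 ≤ q * 2 ^ n) : ℝ ≃ₜ ℝ :=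
  (((OrderIso.mulRight₀ ((2 : ℝ) ^ n) (by positivity)).trans
    ((OrderIso.addRight (-(i : ℝ))).trans
    ((periodize (rampIso m) (cells_pos h) (rampIso_zero m) (rampIso_cells h)).trans
    (OrderIso.addRight (i : ℝ))))).trans
    (OrderIso.mulRight₀ ((2 : ℝ) ^ n) (by positivity)).symm).toHomeomorph

theorem bumpHomeo_strictMono (q n : ℕ) (i : ℤ) (m : ℕ) (h : m + 3 ≤ q * 2 ^ n) :
    StrictMono (bumpHomeo q n i m h) := OrderIso.strictMono _

theorem bumpHomeo_apply_of_period (q n : ℕ) (i : ℤ) (m : ℕ) (h : m + 3 ≤ q * 2 ^ n) (k : ℤ)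
    {t : ℝ} (h0 : i + k * (q * 2 ^ n) ≤ t * 2 ^ n) (h1 : t * 2 ^ n ≤ i + (k + 1) * (q * 2 ^ n)) :
    bumpHomeo q n i m h t =
      (ramp m (t * 2 ^ n - i - k * (q * 2 ^ n)) + k * (q * 2 ^ n) + i) / 2 ^ n := by
  change (periodize (rampIso m) (cells_pos h) (rampIso_zero m) (rampIso_cells h)
    (t * 2 ^ n + -(i : ℝ)) + i) * (2 ^ n)⁻¹ = _
  have h2 : t * 2 ^ n + -(i : ℝ) =
      (t * 2 ^ n - i - k * (q * 2 ^ n)) + k * ((q * 2 ^ n : ℕ) : ℝ) := by push_cast; ring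
  rw [h2, periodize_apply _ _ _ _ k (by linarith) (by push_cast; linarith)]
  push_cast
  rfl

/-- The value of a bump on the part of the line where no other period interferes. -/
theorem bumpHomeo_apply (q n : ℕ) (i : ℤ) (m : ℕ) (h : m + 3 ≤ q * 2 ^ n)
    {t : ℝ} (h0 : i + m + 3 - q * 2 ^ n ≤ t * 2 ^ n) (h1 : t * 2 ^ n ≤ i + q * 2 ^ n) :
    bumpHomeo q n i m h t = (ramp m (t * 2 ^ n - i) + i) / 2 ^ n := by
  have hm : (0 : ℝ) ≤ m := by positivity
  rcases le_total (i : ℝ) (t * 2 ^ n) with h2 | h2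
  · have := bumpHomeo_apply_of_period q n i m h 0 (t := t) (by simpa using h2) (by simpa using h1)
    simpa using this
  · rw [bumpHomeo_apply_of_period q n i m h (-1) (t := t) (by push_cast; linarith)
      (by push_cast; linarith), ramp_of_ge m (by push_cast; linarith), ramp_of_nonpos m (by linarith)]
    ring

theorem bumpHomeo_apply_add (q n : ℕ) (i : ℤ) (m : ℕ) (h : m + 3 ≤ q * 2 ^ n) (t : ℝ) :
    bumpHomeo q n i m h (t + q) = bumpHomeo q n i m h t + q := by
  have hQ : (0 : ℝ) < q * 2 ^ n := by exact_mod_cast cells_pos h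
  have h2 := (div_lt_iff₀ hQ).1 (Int.lt_floor_add_one ((t * 2 ^ n - i) / (q * 2 ^ n)))
  have h3 := (le_div_iff₀ hQ).1 (Int.floor_le ((t * 2 ^ n - i) / (q * 2 ^ n)))
  generalize ⌊(t * 2 ^ n - i) / (q * 2 ^ n)⌋ = k at h2 h3
  rw [bumpHomeo_apply_of_period q n i m h k (t := t) (by linarith) (by linarith),
    bumpHomeo_apply_of_period q n i m h (k + 1) (t := t + q) (by push_cast; linarith)
      (by push_cast; linarith)]
  have : (t + q) * 2 ^ n - i - ((k + 1 : ℤ) : ℝ) * (q * 2 ^ n) = t * 2 ^ n - i - k * (q * 2 ^ n) := by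
    push_cast
    ring
  rw [this]
  push_cast
  field_simp
  ring

theorem ramp_affine (m : ℕ) (J : ℤ) : ∃ (k : ℤ) (b : ℝ), b ∈ dyadic ∧
    ∀ s : ℝ, (J : ℝ) ≤ s → s ≤ J + 1 → ramp m s = 2 ^ k * s + b := by
  rcases lt_or_ge J 0 with h | h
  · have h' : (J : ℝ) + 1 ≤ 0 := by exact_mod_cast h
    exact ⟨0, 0, by simpa using dyadic_intCast 0, fun s _ _ => by
      rw [ramp_of_nonpos m (by linarith)]; simp⟩
  rcases lt_or_ge J 1 with h1 | h1
  · obtain rfl : J = 0 := by omega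
    exact ⟨1, 0, by simpa using dyadic_intCast 0, fun s hs hs' => by
      rw [ramp_of_le_one m (by simpa using hs) (by simpa using hs')]; simp⟩
  have h1' : (1 : ℝ) ≤ J := by exact_mod_cast h1
  rcases lt_or_ge J (m + 1) with h2 | h2
  · have h' : (J : ℝ) + 1 ≤ m + 1 := by exact_mod_cast h2
    exact ⟨0, 1, by simpa using dyadic_intCast 1, fun s _ _ => by
      rw [ramp_of_mid m (by linarith) (by linarith)]; simp⟩
  have h2' : (m : ℝ) + 1 ≤ J := by exact_mod_cast h2
  rcases lt_or_ge J (m + 3) with h3 | h3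
  · have h' : (J : ℝ) + 1 ≤ m + 3 := by exact_mod_cast h3
    exact ⟨-1, (m + 3) / 2, by simpa using dyadic_int_div_pow (m + 3) 1, fun s _ _ => by
      rw [ramp_of_end m (by linarith) (by linarith)]; simp; ring⟩
  · have h' : (m : ℝ) + 3 ≤ J := by exact_mod_cast h3
    exact ⟨0, 0, by simpa using dyadic_intCast 0, fun s _ _ => by
      rw [ramp_of_ge m (by linarith)]; simp⟩

theorem bumpHomeo_mem_Hp (q n : ℕ) (i : ℤ) (m : ℕ) (h : m + 3 ≤ q * 2 ^ n) :
    bumpHomeo q n i m h ∈ Hp q := by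
  refine mem_Hp_of_grid (bumpHomeo_strictMono q n i m h) n (bumpHomeo_apply_add q n i m h) ?_
  intro j
  have hQ : (0 : ℤ) < q * 2 ^ n := by exact_mod_cast cells_pos h
  set k : ℤ := (j - i) / (q * 2 ^ n) with hk
  have hk1 : i + k * (q * 2 ^ n) ≤ j := by
    have := Int.ediv_mul_le (j - i) hQ.ne'
    linarith
  have hk2 : j + 1 ≤ i + (k + 1) * (q * 2 ^ n) := by
    have := Int.lt_ediv_add_one_mul_self (j - i) hQ
    linarith
  have hk1' : (i : ℝ) + k * (q * 2 ^ n) ≤ j := by exact_mod_cast hk1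
  have hk2' : (j : ℝ) + 1 ≤ i + (k + 1) * (q * 2 ^ n) := by exact_mod_cast hk2
  obtain ⟨e, b, hb, hr⟩ := ramp_affine m (j - i - k * (q * 2 ^ n))
  refine ⟨e, (2 ^ e * (-(i + k * (q * 2 ^ n) : ℤ)) + b + (k * (q * 2 ^ n) + i : ℤ)) * 2 ^ (-n : ℤ),
    ?_, fun t ht ht' => ?_⟩
  · exact dyadic_mul (dyadic_add (dyadic_add (dyadic_mul (dyadic_zpow e)
      (dyadic_neg (dyadic_intCast _))) hb) (dyadic_intCast _)) (dyadic_zpow _)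
  · rw [bumpHomeo_apply_of_period q n i m h k (by linarith) (by linarith),
      hr _ (by push_cast; linarith) (by push_cast; linarith)]
    rw [zpow_neg, zpow_natCast]
    push_cast
    field_simp
    ring

theorem le_ramp (m : ℕ) (s : ℝ) : s ≤ ramp m s := le_max_left _ _

theorem ramp_le_of_le {m : ℕ} {s c : ℝ} (hs : s ≤ c) (hc : m + 3 ≤ c) : ramp m s ≤ c := by
  rcases le_total (m + 3 : ℝ) s with h | h
  · rwa [ramp_of_ge m h]
  · refine ((ramp_strictMono m).monotone h).trans ?_
    rwa [ramp_of_ge m le_rfl]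

theorem ramp_cases (m : ℕ) (s : ℝ) :
    (s ≤ 0 ∧ ramp m s = s) ∨ (0 ≤ s ∧ s ≤ 1 ∧ ramp m s = 2 * s) ∨
    (1 ≤ s ∧ s ≤ m + 1 ∧ ramp m s = s + 1) ∨
    (m + 1 ≤ s ∧ s ≤ m + 3 ∧ ramp m s = (s + m + 3) / 2) ∨ (m + 3 ≤ s ∧ ramp m s = s) := by
  rcases le_total s 0 with h | h
  · exact .inl ⟨h, ramp_of_nonpos m h⟩
  rcases le_total s 1 with h1 | h1
  · exact .inr (.inl ⟨h, h1, ramp_of_le_one m h h1⟩)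
  rcases le_total s (m + 1) with h2 | h2
  · exact .inr (.inr (.inl ⟨h1, h2, ramp_of_mid m h1 h2⟩))
  rcases le_total s (m + 3) with h3 | h3
  · exact .inr (.inr (.inr (.inl ⟨h2, h3, ramp_of_end m h2 h3⟩)))
  · exact .inr (.inr (.inr (.inr ⟨h3, ramp_of_ge m h3⟩)))

/-! ### Relations between ramps, transported to bumps -/

/-- The ramp based at `2` fixes everything below `2` and stretches `[2, 3]` to `[2, 4]`, so
conjugation by it lengthens the support `[0, 3]` to `[0, 4]`. -/
theorem ramp_zero_conj_ramp_one (s : ℝ) :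
    ramp 0 (ramp 0 s - 2) + 2 = ramp 1 (ramp 0 (s - 2) + 2) := by
  have h1 := ramp_cases 0 s
  have h2 := ramp_cases 0 (s - 2)
  have h3 := ramp_cases 0 (ramp 0 s - 2)
  have h4 := ramp_cases 1 (ramp 0 (s - 2) + 2)
  push_cast at *
  grind (splits := 40)

/-- The long ramp based at `-1` is translation by `1` on `[0, 3]`, the support of `ramp 0`. -/
theorem ramp_zero_conj_translate (s : ℝ) :
    ramp 3 (ramp 0 s + 1) - 1 = ramp 0 (ramp 3 (s + 1) - 1 - 1) + 1 := by
  have h1 := ramp_cases 0 s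
  have h2 := ramp_cases 3 (s + 1)
  have h3 := ramp_cases 3 (ramp 0 s + 1)
  have h4 := ramp_cases 0 (ramp 3 (s + 1) - 1 - 1)
  push_cast at *
  grind (splits := 40)

/-- The quarter-scale copy of `ramp 1` is supported on `[0, 1]`, where `ramp 0` is doubling;
conjugation therefore yields the half-scale copy. -/
theorem ramp_one_conj_rescale (s : ℝ) :
    ramp 0 (ramp 1 (4 * s) / 4) = ramp 1 (2 * ramp 0 s) / 2 := by
  have h1 := ramp_cases 0 s
  have h2 := ramp_cases 1 (4 * s)
  have h3 := ramp_cases 0 (ramp 1 (4 * s) / 4)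
  have h4 := ramp_cases 1 (2 * ramp 0 s)
  push_cast at *
  grind (splits := 40)

/-- A half-scale `ramp 1` creates the initial slope `2` and meets `ramp m`, based at `1`, so that
the slopes combine. This is the only relation that is not a conjugation, and it drives the induction
on `m`. -/
theorem ramp_succ (m : ℕ) (s : ℝ) :
    ramp (m + 1) s = ramp m (ramp 1 (2 * s) / 2 - 1) + 1 := by
  have h0 : (0 : ℝ) ≤ m := by positivity
  have h1 := ramp_cases (m + 1) s
  have h2 := ramp_cases 1 (2 * s)
  have h3 := ramp_cases m (ramp 1 (2 * s) / 2 - 1)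
  push_cast at *
  grind (splits := 40)
theorem bumpHomeo_mul_two_pow (q n : ℕ) (i : ℤ) (m : ℕ) (h : m + 3 ≤ q * 2 ^ n)
    {t : ℝ} (h0 : i + m + 3 - q * 2 ^ n ≤ t * 2 ^ n) (h1 : t * 2 ^ n ≤ i + q * 2 ^ n) :
    bumpHomeo q n i m h t * 2 ^ n = ramp m (t * 2 ^ n - i) + i := by
  rw [bumpHomeo_apply q n i m h h0 h1, div_mul_cancel₀ _ (by positivity)]

theorem one_le_of_cells {q n m : ℕ} (h : m + 3 ≤ q * 2 ^ n) : 1 ≤ q := by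
  rcases q.eq_zero_or_pos with rfl | h'
  · omega
  · exact h'

/-- Comparison of two elements of `H_q` through the rescaled coordinate. -/
theorem Hp.ext_mul_two_pow {q : ℕ} (hq : 1 ≤ q) {f g : ℝ ≃ₜ ℝ} (hf : f ∈ Hp q) (hg : g ∈ Hp q)
    (n : ℕ) (a : ℝ) (h : ∀ t : ℝ, a ≤ t * 2 ^ n → t * 2 ^ n ≤ a + q * 2 ^ n →
      f t * 2 ^ n = g t * 2 ^ n) : f = g := by
  refine Hp.ext hq hf hg (a / 2 ^ n) fun t h0 h1 => ?_
  have hn : (0 : ℝ) < 2 ^ n := by positivity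
  refine mul_right_cancel₀ hn.ne' (h t ((div_le_iff₀ hn).1 h0) ?_)
  have := mul_le_mul_of_nonneg_right h1 hn.le
  rwa [add_mul, div_mul_cancel₀ _ hn.ne'] at this

theorem bumpHomeo_zero_conj_one {q n : ℕ} (h : 6 ≤ q * 2 ^ n) (h0 : 0 + 3 ≤ q * 2 ^ n)
    (h1 : 1 + 3 ≤ q * 2 ^ n) :
    bumpHomeo q n 2 0 h0 * bumpHomeo q n 0 0 h0 = bumpHomeo q n 0 1 h1 * bumpHomeo q n 2 0 h0 := by
  have hQ : (6 : ℝ) ≤ q * 2 ^ n := by exact_mod_cast h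
  refine Hp.ext_mul_two_pow (one_le_of_cells h0)
    (mul_mem (bumpHomeo_mem_Hp ..) (bumpHomeo_mem_Hp ..))
    (mul_mem (bumpHomeo_mem_Hp ..) (bumpHomeo_mem_Hp ..)) n 0 fun t ht ht' => ?_
  change bumpHomeo q n 2 0 h0 (bumpHomeo q n 0 0 h0 t) * 2 ^ n =
    bumpHomeo q n 0 1 h1 (bumpHomeo q n 2 0 h0 t) * 2 ^ n
  have e1 := bumpHomeo_mul_two_pow q n 0 0 h0 (t := t) (by push_cast; linarith)
    (by push_cast; linarith)
  have e2 := bumpHomeo_mul_two_pow q n 2 0 h0 (t := t) (by push_cast; linarith)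
    (by push_cast; linarith)
  have b1 := le_ramp 0 (t * 2 ^ n)
  have b2 := le_ramp 0 (t * 2 ^ n - 2)
  have b3 : ramp 0 (t * 2 ^ n) ≤ q * 2 ^ n :=
    ramp_le_of_le (by linarith) (by push_cast; linarith)
  have b4 : ramp 0 (t * 2 ^ n - 2) ≤ q * 2 ^ n - 2 :=
    ramp_le_of_le (by linarith) (by push_cast; linarith)
  push_cast at e1 e2
  rw [sub_zero, add_zero] at e1
  rw [bumpHomeo_mul_two_pow q n 2 0 h0 (by push_cast; linarith) (by push_cast; linarith),
    bumpHomeo_mul_two_pow q n 0 1 h1 (by push_cast; linarith) (by push_cast; linarith), e1, e2]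
  push_cast
  rw [sub_zero, add_zero, ramp_zero_conj_ramp_one]

theorem bumpHomeo_zero_conj_translate {q n : ℕ} (h : 6 ≤ q * 2 ^ n) (h0 : 0 + 3 ≤ q * 2 ^ n)
    (h1 : 3 + 3 ≤ q * 2 ^ n) :
    bumpHomeo q n (-1) 3 h1 * bumpHomeo q n 0 0 h0 =
      bumpHomeo q n 1 0 h0 * bumpHomeo q n (-1) 3 h1 := by
  have hQ : (6 : ℝ) ≤ q * 2 ^ n := by exact_mod_cast h
  refine Hp.ext_mul_two_pow (one_le_of_cells h0)
    (mul_mem (bumpHomeo_mem_Hp ..) (bumpHomeo_mem_Hp ..))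
    (mul_mem (bumpHomeo_mem_Hp ..) (bumpHomeo_mem_Hp ..)) n (-1) fun t ht ht' => ?_
  change bumpHomeo q n (-1) 3 h1 (bumpHomeo q n 0 0 h0 t) * 2 ^ n =
    bumpHomeo q n 1 0 h0 (bumpHomeo q n (-1) 3 h1 t) * 2 ^ n
  have e1 := bumpHomeo_mul_two_pow q n 0 0 h0 (t := t) (by push_cast; linarith)
    (by push_cast; linarith)
  have e2 := bumpHomeo_mul_two_pow q n (-1) 3 h1 (t := t) (by push_cast; linarith)
    (by push_cast; linarith)
  have b1 := le_ramp 0 (t * 2 ^ n)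
  have b2 := le_ramp 3 (t * 2 ^ n + 1)
  have b3 : ramp 0 (t * 2 ^ n) ≤ q * 2 ^ n - 1 :=
    ramp_le_of_le (by linarith) (by push_cast; linarith)
  have b4 : ramp 3 (t * 2 ^ n + 1) ≤ q * 2 ^ n :=
    ramp_le_of_le (by linarith) (by push_cast; linarith)
  push_cast at e1 e2
  rw [sub_zero, add_zero] at e1
  rw [sub_neg_eq_add, ← sub_eq_add_neg] at e2
  rw [bumpHomeo_mul_two_pow q n (-1) 3 h1 (by push_cast; linarith) (by push_cast; linarith),
    bumpHomeo_mul_two_pow q n 1 0 h0 (by push_cast; linarith) (by push_cast; linarith), e1, e2]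
  push_cast
  rw [sub_neg_eq_add, ← sub_eq_add_neg, ramp_zero_conj_translate]

theorem bumpHomeo_one_conj_rescale {q n : ℕ} (h0 : 0 + 3 ≤ q * 2 ^ n)
    (h1 : 1 + 3 ≤ q * 2 ^ (n + 1)) (h2 : 1 + 3 ≤ q * 2 ^ (n + 2)) :
    bumpHomeo q n 0 0 h0 * bumpHomeo q (n + 2) 0 1 h2 =
      bumpHomeo q (n + 1) 0 1 h1 * bumpHomeo q n 0 0 h0 := by
  have hQ : (3 : ℝ) ≤ q * 2 ^ n := by exact_mod_cast h0
  refine Hp.ext_mul_two_pow (one_le_of_cells h0)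
    (mul_mem (bumpHomeo_mem_Hp ..) (bumpHomeo_mem_Hp ..))
    (mul_mem (bumpHomeo_mem_Hp ..) (bumpHomeo_mem_Hp ..)) n 0 fun t ht ht' => ?_
  change bumpHomeo q n 0 0 h0 (bumpHomeo q (n + 2) 0 1 h2 t) * 2 ^ n =
    bumpHomeo q (n + 1) 0 1 h1 (bumpHomeo q n 0 0 h0 t) * 2 ^ n
  have p1 : (2 : ℝ) ^ (n + 1) = 2 * 2 ^ n := by ring
  have p2 : (2 : ℝ) ^ (n + 2) = 4 * 2 ^ n := by ring
  have e1 := bumpHomeo_mul_two_pow q (n + 2) 0 1 h2 (t := t) (by rw [p2]; push_cast; linarith)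
    (by rw [p2]; push_cast; linarith)
  have e2 := bumpHomeo_mul_two_pow q n 0 0 h0 (t := t) (by push_cast; linarith)
    (by push_cast; linarith)
  have b1 := le_ramp 1 (4 * (t * 2 ^ n))
  have b2 := le_ramp 0 (t * 2 ^ n)
  have b3 : ramp 1 (4 * (t * 2 ^ n)) ≤ 4 * (q * 2 ^ n) :=
    ramp_le_of_le (by linarith) (by push_cast; linarith)
  have b4 : ramp 0 (t * 2 ^ n) ≤ q * 2 ^ n :=
    ramp_le_of_le (by linarith) (by push_cast; linarith)
  rw [p2] at e1
  push_cast at e1 e2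
  rw [sub_zero, add_zero] at e1 e2
  rw [mul_left_comm t] at e1
  have e3 : bumpHomeo q (n + 2) 0 1 h2 t * 2 ^ n = ramp 1 (4 * (t * 2 ^ n)) / 4 := by linarith
  have e4 := bumpHomeo_mul_two_pow q (n + 1) 0 1 h1 (t := bumpHomeo q n 0 0 h0 t)
    (by rw [p1]; push_cast; linarith) (by rw [p1]; push_cast; linarith)
  rw [p1, mul_left_comm (bumpHomeo q n 0 0 h0 t), e2] at e4
  push_cast at e4
  rw [sub_zero, add_zero] at e4
  rw [bumpHomeo_mul_two_pow q n 0 0 h0 (by push_cast; linarith) (by push_cast; linarith), e3]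
  push_cast
  rw [sub_zero, add_zero, ramp_one_conj_rescale]
  linarith

theorem bumpHomeo_succ {q n m : ℕ} (i : ℤ) (h0 : m + 3 ≤ q * 2 ^ n) (h1 : m + 1 + 3 ≤ q * 2 ^ n)
    (h2 : 1 + 3 ≤ q * 2 ^ (n + 1)) :
    bumpHomeo q n i (m + 1) h1 = bumpHomeo q n (i + 1) m h0 * bumpHomeo q (n + 1) (2 * i) 1 h2 := by
  have hm : (0 : ℝ) ≤ m := by positivity
  have hQ : (m : ℝ) + 1 + 3 ≤ q * 2 ^ n := by exact_mod_cast h1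
  refine Hp.ext_mul_two_pow (one_le_of_cells h0) (bumpHomeo_mem_Hp ..)
    (mul_mem (bumpHomeo_mem_Hp ..) (bumpHomeo_mem_Hp ..)) n i fun t ht ht' => ?_
  change _ = bumpHomeo q n (i + 1) m h0 (bumpHomeo q (n + 1) (2 * i) 1 h2 t) * 2 ^ n
  have p1 : (2 : ℝ) ^ (n + 1) = 2 * 2 ^ n := by ring
  have e1 := bumpHomeo_mul_two_pow q (n + 1) (2 * i) 1 h2 (t := t)
    (by rw [p1]; push_cast; linarith) (by rw [p1]; push_cast; linarith)
  have b1 := le_ramp 1 (2 * (t * 2 ^ n - i))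
  have b2 : ramp 1 (2 * (t * 2 ^ n - i)) ≤ 2 * (q * 2 ^ n) :=
    ramp_le_of_le (by linarith) (by push_cast; linarith)
  rw [p1] at e1
  push_cast at e1
  rw [mul_left_comm t, ← mul_sub] at e1
  have e3 : bumpHomeo q (n + 1) (2 * i) 1 h2 t * 2 ^ n = ramp 1 (2 * (t * 2 ^ n - i)) / 2 + i := by
    linarith
  rw [bumpHomeo_mul_two_pow q n i (m + 1) h1 (by push_cast; linarith) (by linarith),
    bumpHomeo_mul_two_pow q n (i + 1) m h0 (by push_cast; linarith) (by push_cast; linarith), e3,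
    ramp_succ]
  push_cast
  have : ramp 1 (2 * (t * 2 ^ n - i)) / 2 + i - (i + 1) = ramp 1 (2 * (t * 2 ^ n - i)) / 2 - 1 := by
    ring
  rw [this]
  ring

theorem shift_conj_bumpHomeo {q n m : ℕ} (i j : ℤ) (h : m + 3 ≤ q * 2 ^ n) :
    shift (j / 2 ^ n) * bumpHomeo q n i m h * (shift (j / 2 ^ n))⁻¹ =
      bumpHomeo q n (i + j) m h := by
  have hd : shift ((j : ℝ) / 2 ^ n) ∈ Hp q := shift_mem_Hp (dyadic_int_div_pow j n) q
  refine Hp.ext_mul_two_pow (one_le_of_cells h)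
    (mul_mem (mul_mem hd (bumpHomeo_mem_Hp ..)) (inv_mem hd))
    (bumpHomeo_mem_Hp ..) n (i + j) fun t ht ht' => ?_
  have hm : (0 : ℝ) ≤ m := by positivity
  have hQ : (m : ℝ) + 3 ≤ q * 2 ^ n := by exact_mod_cast h
  change shift (j / 2 ^ n) (bumpHomeo q n i m h ((shift (j / 2 ^ n))⁻¹ t)) * 2 ^ n = _
  have e : (t - j / 2 ^ n) * 2 ^ n = t * 2 ^ n - j := by field_simp
  rw [shift_inv_apply, shift_apply, add_mul, div_mul_cancel₀ _ (by positivity),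
    bumpHomeo_mul_two_pow q n i m h (by rw [e]; linarith) (by rw [e]; linarith),
    bumpHomeo_mul_two_pow q n (i + j) m h (by push_cast; linarith) (by push_cast; linarith), e]
  push_cast
  have : t * 2 ^ n - j - i = t * 2 ^ n - (i + j) := by ring
  rw [this]
  ring

/-! ### Bumps modulo a normal subgroup -/

/-- All points moved by `g` lie within `η` of a multiple of `q`. -/
def MovesNear (q : ℕ) (η : ℝ) (g : ℝ ≃ₜ ℝ) : Prop :=
  ∀ t, g t ≠ t → ∃ k : ℤ, |t - k * q| < η

theorem bumpHomeo_movesNear {q n m : ℕ} {i : ℤ} (h : m + 3 ≤ q * 2 ^ n) {η : ℝ}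
    (h0 : -(η * 2 ^ n) ≤ i) (h1 : i + m + 3 ≤ η * 2 ^ n) :
    MovesNear q η (bumpHomeo q n i m h) := by
  intro t ht
  have hn : (0 : ℝ) < 2 ^ n := by positivity
  have hQ : (0 : ℝ) < q * 2 ^ n := by exact_mod_cast cells_pos h
  have h2 := (div_lt_iff₀ hQ).1 (Int.lt_floor_add_one ((t * 2 ^ n - i) / (q * 2 ^ n)))
  have h3 := (le_div_iff₀ hQ).1 (Int.floor_le ((t * 2 ^ n - i) / (q * 2 ^ n)))
  generalize ⌊(t * 2 ^ n - i) / (q * 2 ^ n)⌋ = k at h2 h3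
  have e := bumpHomeo_apply_of_period q n i m h k (t := t) (by linarith) (by linarith)
  have h4 : ramp m (t * 2 ^ n - i - k * (q * 2 ^ n)) ≠ t * 2 ^ n - i - k * (q * 2 ^ n) := by
    intro h5
    apply ht
    rw [e, h5]
    field_simp
    ring
  have h5 : 0 < t * 2 ^ n - i - k * (q * 2 ^ n) := by
    by_contra! h6
    exact h4 (ramp_of_nonpos m h6)
  have h6 : t * 2 ^ n - i - k * (q * 2 ^ n) < m + 3 := by
    by_contra! h6
    exact h4 (ramp_of_ge m h6)
  refine ⟨k, ?_⟩
  rw [abs_lt]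
  constructor
  · refine lt_of_mul_lt_mul_right ?_ hn.le
    linarith
  · refine lt_of_mul_lt_mul_right ?_ hn.le
    linarith

/-- `bumpHomeo` as an element of `H`. -/
noncomputable def bump (q n : ℕ) (i : ℤ) (m : ℕ) (h : m + 3 ≤ q * 2 ^ n) : H :=
  ⟨bumpHomeo q n i m h, Hp_le_H (one_le_of_cells h) (bumpHomeo_mem_Hp q n i m h)⟩

/-- Elements of `H_q` which move only points close to multiples of `q` commute modulo the normal subgroup `N`. -/
def CommuteNear (N : Subgroup H) (q : ℕ) (η : ℝ) : Prop :=
  ∀ g h : H, (g : ℝ ≃ₜ ℝ) ∈ Hp q → (h : ℝ ≃ₜ ℝ) ∈ Hp q → MovesNear q η g → MovesNear q η h →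
    g * h * g⁻¹ * h⁻¹ ∈ N

theorem commute_mk {G : Type*} [Group G] {N : Subgroup G} [N.Normal] {g h : G}
    (hgh : g * h * g⁻¹ * h⁻¹ ∈ N) : (g : G ⧸ N) * h = h * g := by
  have : (g : G ⧸ N) * h * (g : G ⧸ N)⁻¹ * (h : G ⧸ N)⁻¹ = 1 :=
    (QuotientGroup.eq_one_iff (g * h * g⁻¹ * h⁻¹)).2 hgh
  rwa [mul_inv_eq_one, mul_inv_eq_iff_eq_mul] at this

section

variable {N : Subgroup H} [N.Normal] {q : ℕ} {η : ℝ}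

/-- The translation along the grid belongs to `H`, though not a priori to `N`; normality is enough
to make the position of a bump irrelevant. -/
theorem bump_mem_of_bump_mem {n m : ℕ} {i : ℤ} (j : ℤ) {h : m + 3 ≤ q * 2 ^ n}
    (hb : bump q n i m h ∈ N) : bump q n j m h ∈ N := by
  have hd : shift (((j - i : ℤ) : ℝ) / 2 ^ n) ∈ H :=
    Hp_le_H (one_le_of_cells h) (shift_mem_Hp (dyadic_int_div_pow (j - i) n) q)
  have := Subgroup.Normal.conj_mem ‹N.Normal› _ hb ⟨_, hd⟩
  convert this using 1
  apply Subtype.ext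
  change _ = shift (((j - i : ℤ) : ℝ) / 2 ^ n) * bumpHomeo q n i m h * (shift _)⁻¹
  rw [shift_conj_bumpHomeo, add_sub_cancel]
  rfl

theorem CommuteNear.bump_comm (hN : CommuteNear N q η) {n n' m m' : ℕ} {i i' : ℤ}
    (h : m + 3 ≤ q * 2 ^ n) (h' : m' + 3 ≤ q * 2 ^ n') (h0 : -(η * 2 ^ n) ≤ i)
    (h1 : i + m + 3 ≤ η * 2 ^ n) (h0' : -(η * 2 ^ n') ≤ i') (h1' : i' + m' + 3 ≤ η * 2 ^ n') :
    (bump q n i m h : H ⧸ N) * bump q n' i' m' h' = bump q n' i' m' h' * bump q n i m h :=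
  commute_mk (hN _ _ (bumpHomeo_mem_Hp q n i m h) (bumpHomeo_mem_Hp q n' i' m' h')
    (bumpHomeo_movesNear h h0 h1) (bumpHomeo_movesNear h' h0' h1'))

/-- Modulo `N` the conjugators in the first three relations commute with what they conjugate. Write
`a`, `a'` for the bumps of length parameter `0` at positions `0`, `1` and `b`, `b'` for those of
parameter `1` at scales `n + 1`, `n + 2`. The relations give `a = b`, `a = a'`, `b' = b`, and the
factorization `b = a' * b'` then kills `b'`, hence `b` and `a`. -/
theorem bump_base_mem (hN : CommuteNear N q η) {n : ℕ} (hn : 6 ≤ q * 2 ^ n) (hη : 6 ≤ η * 2 ^ n)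
    (h0 : 0 + 3 ≤ q * 2 ^ (n + 1)) (h2 : 1 + 3 ≤ q * 2 ^ (n + 2)) :
    bump q (n + 1) 0 0 h0 ∈ N ∧ bump q (n + 2) 0 1 h2 ∈ N := by
  have hn1 : 6 ≤ q * 2 ^ (n + 1) := by rw [pow_succ]; lia
  have hη1 : 6 ≤ η * 2 ^ (n + 1) := by rw [pow_succ]; linarith
  have hη2 : 6 ≤ η * 2 ^ (n + 2) := by rw [pow_succ, pow_succ]; linarith
  have h1 : 1 + 3 ≤ q * 2 ^ (n + 1) := by omega
  have h3 : 3 + 3 ≤ q * 2 ^ (n + 1) := by omega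
  have hY : 0 + 3 ≤ q * 2 ^ n := by omega
  have r1 : bump q (n + 1) 2 0 h0 * bump q (n + 1) 0 0 h0 =
      bump q (n + 1) 0 1 h1 * bump q (n + 1) 2 0 h0 :=
    Subtype.ext (bumpHomeo_zero_conj_one hn1 h0 h1)
  have r2 : bump q (n + 1) (-1) 3 h3 * bump q (n + 1) 0 0 h0 =
      bump q (n + 1) 1 0 h0 * bump q (n + 1) (-1) 3 h3 :=
    Subtype.ext (bumpHomeo_zero_conj_translate hn1 h0 h3)
  have r3 : bump q n 0 0 hY * bump q (n + 2) 0 1 h2 = bump q (n + 1) 0 1 h1 * bump q n 0 0 hY :=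
    Subtype.ext (bumpHomeo_one_conj_rescale hY h1 h2)
  have r4 : bump q (n + 1) 0 1 h1 = bump q (n + 1) 1 0 h0 * bump q (n + 2) 0 1 h2 :=
    Subtype.ext (bumpHomeo_succ 0 h0 h1 h2)
  -- All bumps involved are supported within `6 / 2 ^ n ≤ η` of multiples of `q`, so they commute
  -- modulo `N`.
  have c1 := hN.bump_comm (i := 2) (i' := 0) h0 h0 (by push_cast; linarith) (by push_cast; linarith)
    (by push_cast; linarith) (by push_cast; linarith)
  have c2 := hN.bump_comm (i := -1) (i' := 0) h3 h0 (by push_cast; linarith) (by push_cast; linarith)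
    (by push_cast; linarith) (by push_cast; linarith)
  have c3 := hN.bump_comm (i := 0) (i' := 0) hY h2 (by push_cast; linarith) (by push_cast; linarith)
    (by push_cast; linarith) (by push_cast; linarith)
  replace r1 := congrArg (QuotientGroup.mk (s := N)) r1
  replace r2 := congrArg (QuotientGroup.mk (s := N)) r2
  replace r3 := congrArg (QuotientGroup.mk (s := N)) r3
  replace r4 := congrArg (QuotientGroup.mk (s := N)) r4
  simp only [QuotientGroup.mk_mul] at r1 r2 r3 r4
  rw [c1] at r1
  rw [c2] at r2
  rw [c3] at r3
  have s1 := mul_right_cancel r1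
  have s2 := mul_right_cancel r2
  have s3 := mul_right_cancel r3
  rw [← s2, ← s1] at r4
  have s4 := left_eq_mul.1 r4
  rw [← QuotientGroup.eq_one_iff, ← QuotientGroup.eq_one_iff]
  exact ⟨by rw [s1, ← s3, s4], s4⟩

theorem bump_mem (hN : CommuteNear N q η) {n : ℕ} (hn : 6 ≤ q * 2 ^ n) (hη : 6 ≤ η * 2 ^ n)
    (i : ℤ) (m : ℕ) (h : m + 3 ≤ q * 2 ^ (n + 1)) : bump q (n + 1) i m h ∈ N := by
  have h0 : 0 + 3 ≤ q * 2 ^ (n + 1) := by omega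
  have h2 : 1 + 3 ≤ q * 2 ^ (n + 2) := by rw [pow_succ, pow_succ]; lia
  obtain ⟨b0, b1⟩ := bump_base_mem hN hn hη h0 h2
  induction m generalizing i with
  | zero => exact bump_mem_of_bump_mem i b0
  | succ m ih =>
    have h3 : m + 3 ≤ q * 2 ^ (n + 1) := by omega
    have : bump q (n + 1) i (m + 1) h =
        bump q (n + 1) (i + 1) m h3 * bump q (n + 2) (2 * i) 1 h2 :=
      Subtype.ext (bumpHomeo_succ i h3 h h2)
    rw [this]
    exact mul_mem (ih (i + 1) h3) (bump_mem_of_bump_mem _ b1)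

end

/-! ### The commutator trick -/

/-- A nontrivial normal subgroup contains all commutators of elements with small support. -/
theorem exists_commuteNear (N : Subgroup H) [N.Normal] {f : H} (hfN : f ∈ N) {q : ℕ}
    (hf : (f : ℝ ≃ₜ ℝ) ∈ Hp q) (h0 : (f : ℝ ≃ₜ ℝ) 0 ≠ 0) (hq : |(f : ℝ ≃ₜ ℝ) 0| < q) :
    ∃ η > 0, CommuteNear N q η := by
  set y := (f : ℝ ≃ₜ ℝ) 0 with hy
  have hd : 0 < min |y| (q - |y|) := lt_min (abs_pos.2 h0) (by linarith)
  -- Since `|y| < q`, this is a positive lower bound for the distance from `y = f 0` to `qℤ`, as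
  -- `hdist` checks.
  set d := min |y| (q - |y|) with hd'
  obtain ⟨δ, hδ, hcont⟩ := Metric.continuousAt_iff.1
    ((f : ℝ ≃ₜ ℝ).continuous.continuousAt (x := 0)) (d / 2) (by positivity)
  refine ⟨min δ (d / 2), lt_min hδ (by positivity), fun g h hg hh hgs hhs => ?_⟩
  have hdist : ∀ k : ℤ, d ≤ |y - k * q| := by
    intro k
    rcases eq_or_ne k 0 with rfl | hk
    · rw [Int.cast_zero, zero_mul, sub_zero]
      exact min_le_left _ _
    · have h1 : (1 : ℝ) ≤ |(k : ℝ)| := by exact_mod_cast Int.one_le_abs hk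
      have h2 : (q : ℝ) ≤ |(k : ℝ) * q| := by
        rw [abs_mul, Nat.abs_cast]
        exact le_mul_of_one_le_left (by positivity) h1
      have h3 := abs_sub_abs_le_abs_sub ((k : ℝ) * q) y
      rw [abs_sub_comm] at h3
      exact (min_le_right _ _).trans (by linarith)
  have hfi : ∀ t, (f : ℝ ≃ₜ ℝ) ((f : ℝ ≃ₜ ℝ).symm t) = t := (f : ℝ ≃ₜ ℝ).apply_symm_apply
  -- A point moved by both would be within `d / 2` of `y + qℤ` and of `qℤ` at once, contradicting
  -- `hdist`.
  have hdisj : Equiv.Perm.Disjoint (f * g⁻¹ * f⁻¹ : H).1.toEquiv h.1.toEquiv := by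
    intro t
    by_contra! hcon
    obtain ⟨hc1, hc2⟩ := hcon
    have hs : (g : ℝ ≃ₜ ℝ) ((f : ℝ ≃ₜ ℝ).symm t) ≠ (f : ℝ ≃ₜ ℝ).symm t := by
      intro h1
      apply hc1
      change (f : ℝ ≃ₜ ℝ) ((g : ℝ ≃ₜ ℝ).symm ((f : ℝ ≃ₜ ℝ).symm t)) = t
      conv_lhs => rw [← h1]
      rw [(g : ℝ ≃ₜ ℝ).symm_apply_apply, hfi]
    obtain ⟨k, hk⟩ := hgs _ hs
    obtain ⟨l, hl⟩ := hhs t hc2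
    have h1 := hcont (x := (f : ℝ ≃ₜ ℝ).symm t - k * q) (by
      rw [Real.dist_eq, sub_zero]
      exact hk.trans_le (min_le_left _ _))
    have h2 := Hp.apply_add_int_mul hf ((f : ℝ ≃ₜ ℝ).symm t) (-k)
    rw [hfi] at h2
    push_cast at h2
    rw [sub_eq_add_neg, ← neg_mul, h2, Real.dist_eq, ← hy] at h1
    have h3 := hdist (l - k)
    have h4 : |t - l * q| < d / 2 := hl.trans_le (min_le_right _ _)
    push_cast at h3
    rw [abs_lt] at h1 h4
    have h5 : |y - (l - k) * q| < d := by
      rw [abs_lt]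
      constructor <;> linarith
    linarith
  have hcomm : f * g⁻¹ * f⁻¹ * h = h * (f * g⁻¹ * f⁻¹) := by
    apply Subtype.ext
    ext t
    exact DFunLike.congr_fun hdisj.commute.eq t
  have hk : g * (f * g⁻¹ * f⁻¹) ∈ N := by
    have := mul_mem (Subgroup.Normal.conj_mem ‹N.Normal› _ hfN g) (inv_mem hfN)
    simpa only [mul_assoc] using this
  -- With `v = f * g⁻¹ * f⁻¹`, this is the commutator of `g * v` and `h`; as `v` commutes with `h`,
  -- it equals that of `g` and `h`.
  have hk' := mul_mem hk (Subgroup.Normal.conj_mem ‹N.Normal› _ (inv_mem hk) h)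
  convert hk' using 1
  generalize f * g⁻¹ * f⁻¹ = v at hcomm
  rw [mul_inv_rev]
  have : h * (v⁻¹ * g⁻¹) * h⁻¹ = v⁻¹ * h * g⁻¹ * h⁻¹ := by
    have : h * v⁻¹ = v⁻¹ * h := by
      rw [mul_inv_eq_iff_eq_mul, mul_assoc, ← hcomm, inv_mul_cancel_left]
    rw [← mul_assoc, this]
  rw [this]
  group

/-! ### Adapted grids and contracted cells -/

/-- Each cell `[j / 2 ^ n, (j + 1) / 2 ^ n]` in `[0, q]` is mapped affinely to a standard dyadic
interval `[u * 2 ^ k, (u + 1) * 2 ^ k]`. -/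
def AdaptedGrid (q n : ℕ) (g : ℝ → ℝ) : Prop :=
  ∀ j : ℤ, 0 ≤ j → j < q * 2 ^ n → ∃ k u : ℤ, ∀ s : ℝ, 0 ≤ s → s ≤ 1 →
    g ((j + s) / 2 ^ n) = (u + s) * 2 ^ k

/-- The length of the image of the cell `[j / 2 ^ n, (j + 1) / 2 ^ n]`. -/
noncomputable def cellLength (n : ℕ) (g : ℝ → ℝ) (j : ℤ) : ℝ :=
  g ((j + 1) / 2 ^ n) - g (j / 2 ^ n)

open Classical in
/-- The cells in `[0, q]` that are contracted. -/
noncomputable def smallCells (q n : ℕ) (g : ℝ → ℝ) : Finset ℤ :=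
  {j ∈ Finset.Ico (0 : ℤ) (q * 2 ^ n) | cellLength n g j < 1 / 2 ^ n}

theorem mem_smallCells {q n : ℕ} {g : ℝ → ℝ} {j : ℤ} :
    j ∈ smallCells q n g ↔ (0 ≤ j ∧ j < q * 2 ^ n) ∧ cellLength n g j < 1 / 2 ^ n := by
  simp [smallCells]

theorem cellLength_eq {n : ℕ} {g : ℝ → ℝ} {j k u : ℤ}
    (h : ∀ s : ℝ, 0 ≤ s → s ≤ 1 → g ((j + s) / 2 ^ n) = (u + s) * 2 ^ k) :
    cellLength n g j = 2 ^ k := by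
  have h0 := h 0 le_rfl zero_le_one
  have h1 := h 1 zero_le_one le_rfl
  rw [add_zero] at h0
  rw [cellLength, h0, h1]
  ring

/-- If no step is below the average `e`, none can exceed it: summing from the left bounds `v j`
below, from the right bounds it above. -/
theorem eq_mul_of_le_steps {v : ℤ → ℝ} {e : ℝ} {Q : ℤ} (h0 : v 0 = 0) (hQ : v Q = Q * e)
    (h : ∀ j, 0 ≤ j → j < Q → e ≤ v (j + 1) - v j) {j : ℤ} (hj : 0 ≤ j) (hj' : j ≤ Q) :
    v j = j * e := by
  apply le_antisymm
  · have : ∀ i : ℕ, (i : ℤ) ≤ Q → v (Q - i) ≤ (Q - i) * e := by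
      intro i
      induction i with
      | zero => simp [hQ]
      | succ i ih =>
        intro hi
        have h1 := h (Q - (i + 1)) (by push_cast at hi; omega) (by omega)
        have h2 := ih (by push_cast at hi; omega)
        have h3 : Q - ((i : ℤ) + 1) + 1 = Q - i := by ring
        rw [h3] at h1
        push_cast
        linarith
    have h1 := this (Q - j).toNat (by omega)
    have h2 : ((Q - j).toNat : ℤ) = Q - j := Int.toNat_of_nonneg (by omega)
    have h3 : (((Q - j).toNat : ℤ) : ℝ) = Q - j := by rw [h2]; push_cast; rfl
    rw [h2, sub_sub_cancel] at h1
    rw [Int.cast_natCast] at h3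
    rw [h3] at h1
    linarith
  · have : ∀ i : ℕ, (i : ℤ) ≤ Q → i * e ≤ v i := by
      intro i
      induction i with
      | zero => simp [h0]
      | succ i ih =>
        intro hi
        have h1 := h i (by omega) (by push_cast at hi; omega)
        have h2 := ih (by push_cast at hi; omega)
        push_cast
        linarith
    lift j to ℕ using hj
    exact_mod_cast this j hj'

/-- Comparison of 2-adic valuations: the left side has valuation exactly `k`, the right side at
least `l`. -/
theorem odd_mul_zpow_eq {a b k l : ℤ} (ha : Odd a) (hkl : k ≤ l)
    (h : (a : ℝ) * 2 ^ k = b * 2 ^ l) : k = l ∧ a = b := by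
  obtain ⟨d, rfl⟩ := Int.le.dest hkl
  rw [zpow_add₀ (by norm_num), mul_left_comm, mul_comm] at h
  have h1 : (a : ℝ) = b * 2 ^ d := by
    have := mul_left_cancel₀ (zpow_ne_zero k (by norm_num)) h
    simpa using this
  have h2 : a = b * 2 ^ d := by exact_mod_cast h1
  rcases d.eq_zero_or_pos with rfl | hd
  · simpa using h2
  · have : Even a := by
      rw [h2]
      exact (Int.even_pow.2 ⟨even_two, hd.ne'⟩).mul_left b
    exact absurd ha (Int.not_odd_iff_even.2 this)

section

variable {q n : ℕ} {g : ℝ → ℝ}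

theorem cell_end (hgq : g q = q) {j : ℤ} (hj : j = q * 2 ^ n) : g (j / 2 ^ n) = q := by
  rw [hj]
  push_cast
  rw [mul_div_cancel_right₀ _ (by positivity), hgq]

/-- A cell with shortest image has a sibling: together they map affinely to a standard interval. -/
theorem exists_siblings (hg : AdaptedGrid q n g) (h0 : g 0 = 0) (hgq : g q = q)
    (hs : (smallCells q n g).Nonempty) :
    ∃ j k u : ℤ, j ∈ smallCells q n g ∧ j + 1 ∈ smallCells q n g ∧
      ∀ s : ℝ, 0 ≤ s → s ≤ 2 → g ((j + s) / 2 ^ n) = (2 * u + s) * 2 ^ k := by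
  obtain ⟨j, hj, hmin⟩ := Finset.exists_min_image _ (cellLength n g) hs
  rw [mem_smallCells] at hj
  obtain ⟨⟨hj0, hjQ⟩, hjs⟩ := hj
  obtain ⟨k, u, hk⟩ := hg j hj0 hjQ
  have hlen := cellLength_eq hk
  have hk0 : k < 0 := by
    rw [hlen] at hjs
    have h1 : (2 : ℝ) ^ k < 2 ^ (0 : ℤ) := by
      refine hjs.trans_le ?_
      rw [zpow_zero, div_le_one (by positivity)]
      exact one_le_pow₀ (by norm_num)
    exact (zpow_lt_zpow_iff_right₀ (by norm_num)).1 h1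
  have hmin' : ∀ i : ℤ, 0 ≤ i → i < q * 2 ^ n → cellLength n g j ≤ cellLength n g i := by
    intro i hi hi'
    by_cases h : i ∈ smallCells q n g
    · exact hmin i h
    · rw [mem_smallCells, not_and, not_lt] at h
      exact hjs.le.trans (h ⟨hi, hi'⟩)
  have hkle : ∀ {i l v : ℤ}, 0 ≤ i → i < q * 2 ^ n →
      (∀ s : ℝ, 0 ≤ s → s ≤ 1 → g ((i + s) / 2 ^ n) = (v + s) * 2 ^ l) → k ≤ l := by
    intro i l v hi hi' hl
    have h1 := hmin' i hi hi'
    rw [hlen, cellLength_eq hl] at h1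
    exact (zpow_le_zpow_iff_right₀ (by norm_num)).1 h1
  -- The parity of `u` decides on which side the sibling lies. The shared endpoint is an odd
  -- multiple of `2 ^ k`, and the neighbour is no shorter, so the neighbour has the same length. The
  -- endpoint is neither `0` nor `q`, because `k < 0`, so the neighbour exists.
  rcases Int.even_or_odd' u with ⟨w, rfl | rfl⟩
  · have hend := hk 1 zero_le_one le_rfl
    have hlt : j + 1 < q * 2 ^ n := by
      refine lt_of_le_of_ne hjQ fun h => ?_
      have h1 := cell_end (n := n) hgq h
      push_cast at h1 hend
      rw [h1] at hend
      have := odd_mul_zpow_eq (a := 2 * w + 1) (b := q) (k := k) (l := 0) ⟨w, rfl⟩ hk0.le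
        (by push_cast; rw [← hend]; simp)
      omega
    obtain ⟨l, v, hl⟩ := hg (j + 1) (by omega) hlt
    have hst := hl 0 le_rfl zero_le_one
    push_cast at hend hst hl
    rw [add_zero, add_zero, hend] at hst
    obtain ⟨rfl, rfl⟩ := odd_mul_zpow_eq (a := 2 * w + 1) ⟨w, rfl⟩ (hkle (by omega) hlt
      (by push_cast; exact hl)) (by push_cast; exact hst)
    refine ⟨j, k, w, mem_smallCells.2 ⟨⟨hj0, hjQ⟩, hjs⟩, mem_smallCells.2 ⟨⟨by omega, hlt⟩, ?_⟩, ?_⟩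
    · rw [cellLength_eq (k := k) (u := 2 * w + 1) (by push_cast at hl ⊢; exact hl), ← hlen]
      exact hjs
    · intro s hs hs'
      rcases le_total s 1 with h | h
      · rw [hk s hs h]
        push_cast
        rfl
      · have h1 := hl (s - 1) (by linarith) (by linarith)
        push_cast at h1
        have h2 : (j : ℝ) + 1 + (s - 1) = j + s := by ring
        rw [h2] at h1
        rw [h1]
        ring
  · have hst := hk 0 le_rfl zero_le_one
    have hpos : 0 < j := by
      refine lt_of_le_of_ne hj0 ?_
      rintro rfl
      simp only [Int.cast_zero, add_zero, zero_div, h0] at hst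
      have := (mul_eq_zero.1 hst.symm).resolve_right (zpow_ne_zero _ (by norm_num))
      have h2 : 2 * w + 1 = 0 := by exact_mod_cast this
      omega
    obtain ⟨l, v, hl⟩ := hg (j - 1) (by omega) (by omega)
    have hend := hl 1 zero_le_one le_rfl
    push_cast at hend hst hl
    rw [sub_add_cancel] at hend
    rw [add_zero, hend, add_zero] at hst
    obtain ⟨rfl, hv⟩ := odd_mul_zpow_eq (a := 2 * w + 1) (b := v + 1) ⟨w, rfl⟩
      (hkle (i := j - 1) (by omega) (by omega) (by push_cast; exact hl))
      (by push_cast; exact hst.symm)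
    obtain rfl : v = 2 * w := by omega
    refine ⟨j - 1, k, w, mem_smallCells.2 ⟨⟨by omega, by omega⟩, ?_⟩, ?_, ?_⟩
    · rw [cellLength_eq (k := k) (u := 2 * w) (by push_cast at hl ⊢; exact hl), ← hlen]
      exact hjs
    · rw [sub_add_cancel]
      exact mem_smallCells.2 ⟨⟨hj0, hjQ⟩, hjs⟩
    · intro s hs hs'
      push_cast
      rcases le_total s 1 with h | h
      · rw [hl s hs h]
        push_cast
        rfl
      · have h1 := hk (s - 1) (by linarith) (by linarith)
        have h2 : (j : ℝ) + (s - 1) = j - 1 + s := by ring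
        rw [h2] at h1
        rw [h1]
        push_cast
        ring

theorem vertex_eq_of_no_small (h0 : g 0 = 0) (hgq : g q = q) (hs : smallCells q n g = ∅) {j : ℤ}
    (hj : 0 ≤ j) (hj' : j ≤ q * 2 ^ n) : g (j / 2 ^ n) = j / 2 ^ n := by
  have h := eq_mul_of_le_steps (v := fun j => g (j / 2 ^ n)) (e := 1 / 2 ^ n) (Q := q * 2 ^ n)
    (by simpa using h0) (by rw [cell_end hgq rfl]; push_cast; field_simp)
    (fun i hi hi' => by
      have h1 : i ∉ smallCells q n g := by simp [hs]
      rw [mem_smallCells, not_and, not_lt] at h1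
      have := h1 ⟨hi, hi'⟩
      rw [cellLength] at this
      push_cast
      exact this) hj hj'
  rw [h]
  ring

theorem exists_big (h0 : g 0 = 0) (hgq : g q = q) (hs : (smallCells q n g).Nonempty) :
    ∃ k : ℤ, 0 ≤ k ∧ k < q * 2 ^ n ∧ 1 / 2 ^ n < cellLength n g k := by
  by_contra! hcon
  have h : ∀ j : ℤ, 0 ≤ j → j ≤ q * 2 ^ n → g (j / 2 ^ n) = j / 2 ^ n := by
    intro j hj hj'
    -- Reflection `x ↦ 2 * x - g x` turns the upper bounds on cell lengths into the lower bounds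
    -- required.
    have h := eq_mul_of_le_steps (v := fun j => 2 * (j / 2 ^ n) - g (j / 2 ^ n)) (e := 1 / 2 ^ n)
      (Q := q * 2 ^ n) (by simpa using h0)
      (by rw [cell_end hgq rfl]; push_cast; field_simp; ring)
      (fun i hi hi' => by
        have h1 := hcon i hi hi'
        rw [cellLength] at h1
        have h2 : ((i : ℝ) + 1) / 2 ^ n = i / 2 ^ n + 1 / 2 ^ n := by ring
        push_cast
        linarith) hj hj'
    have h2 : (j : ℝ) * (1 / 2 ^ n) = j / 2 ^ n := by ring
    linarith
  obtain ⟨j, hj⟩ := hs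
  rw [mem_smallCells] at hj
  obtain ⟨⟨hj0, hj1⟩, hj2⟩ := hj
  have h1 := h j hj0 hj1.le
  have h2 := h (j + 1) (by omega) (by omega)
  push_cast at h2
  rw [cellLength, h1, h2] at hj2
  have h3 : ((j : ℝ) + 1) / 2 ^ n = j / 2 ^ n + 1 / 2 ^ n := by ring
  linarith

/-- Merging two sibling cells and halving an expanded cell reduces the number of contracted
cells. -/
theorem adaptedGrid_of_move {g' : ℝ → ℝ} (hg : AdaptedGrid q n g) {j k e u : ℤ}
    (hj : j ∈ smallCells q n g) (hj1 : j + 1 ∈ smallCells q n g)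
    (hsib : ∀ s : ℝ, 0 ≤ s → s ≤ 2 → g ((j + s) / 2 ^ n) = (2 * u + s) * 2 ^ e)
    (hk0 : 0 ≤ k) (hk1 : k < q * 2 ^ n) (hk : 1 / 2 ^ n < cellLength n g k)
    (σ : ℤ → ℤ) (hσ : Function.Injective σ)
    (h : ∀ i : ℤ, 0 ≤ i → i < q * 2 ^ n →
      (0 ≤ σ i ∧ σ i < q * 2 ^ n ∧ σ i ≠ j + 1 ∧
        ((∀ s : ℝ, 0 ≤ s → s ≤ 1 → g' ((i + s) / 2 ^ n) = g ((σ i + s) / 2 ^ n)) ∨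
          (σ i = j ∧ ∀ s : ℝ, 0 ≤ s → s ≤ 1 → g' ((i + s) / 2 ^ n) = g ((j + 2 * s) / 2 ^ n)))) ∨
      (∀ s : ℝ, 0 ≤ s → s ≤ 1 → g' ((i + s) / 2 ^ n) = g ((k + s / 2) / 2 ^ n)) ∨
      (∀ s : ℝ, 0 ≤ s → s ≤ 1 → g' ((i + s) / 2 ^ n) = g ((k + (1 + s) / 2) / 2 ^ n))) :
    AdaptedGrid q n g' ∧ (smallCells q n g').card < (smallCells q n g).card := by
  obtain ⟨l, w, hl⟩ := hg k hk0 hk1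
  have hhalf : ∀ {i : ℤ} (z : ℤ), (z = 0 ∨ z = 1) →
      (∀ s : ℝ, 0 ≤ s → s ≤ 1 → g' ((i + s) / 2 ^ n) = g ((k + (z + s) / 2) / 2 ^ n)) →
      ∀ s : ℝ, 0 ≤ s → s ≤ 1 → g' ((i + s) / 2 ^ n) = ((2 * w + z : ℤ) + s) * 2 ^ (l - 1) := by
    intro i z hz hi s hs hs'
    have hz' : (0 : ℝ) ≤ z ∧ (z : ℝ) ≤ 1 := by
      rcases hz with rfl | rfl <;> simp
    rw [hi s hs hs', hl _ (by linarith) (by linarith), zpow_sub_one₀ (by norm_num)]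
    push_cast
    ring
  -- Lengths are powers of `2`, so a cell longer than `2 ^ (-n)` is at least twice that, and its
  -- halves are not contracted.
  have hbig : (1 : ℝ) / 2 ^ n ≤ 2 ^ (l - 1) := by
    rw [cellLength_eq hl, one_div, ← zpow_natCast, ← zpow_neg,
      zpow_lt_zpow_iff_right₀ (by norm_num)] at hk
    rw [one_div, ← zpow_natCast, ← zpow_neg]
    exact zpow_le_zpow_right₀ (by norm_num) (by omega)
  constructor
  · intro i hi hi'
    rcases h i hi hi' with ⟨h1, h2, -, h3 | ⟨-, h3⟩⟩ | h3 | h3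
    · obtain ⟨a, b, hab⟩ := hg _ h1 h2
      exact ⟨a, b, fun s hs hs' => (h3 s hs hs').trans (hab s hs hs')⟩
    · refine ⟨e + 1, u, fun s hs hs' => ?_⟩
      rw [h3 s hs hs', hsib _ (by linarith) (by linarith), zpow_add_one₀ (by norm_num)]
      ring
    · exact ⟨_, _, hhalf 0 (.inl rfl) (by simpa using h3)⟩
    · exact ⟨_, _, hhalf 1 (.inr rfl) (by simpa using h3)⟩
  -- `σ` injects the new contracted cells into the old ones and misses `j + 1`, which was
  -- contracted.
  · refine lt_of_le_of_lt (Finset.card_le_card_of_injOn σ (fun i hi => ?_) hσ.injOn)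
      (Finset.card_erase_lt_of_mem hj1)
    rw [SetLike.mem_coe, mem_smallCells] at hi
    obtain ⟨⟨hi, hi'⟩, hlen⟩ := hi
    rw [SetLike.mem_coe, Finset.mem_erase]
    rcases h i hi hi' with ⟨h1, h2, h4, h3 | ⟨h3, -⟩⟩ | h3 | h3
    · refine ⟨h4, mem_smallCells.2 ⟨⟨h1, h2⟩, ?_⟩⟩
      have e0 := h3 0 le_rfl zero_le_one
      have e1 := h3 1 zero_le_one le_rfl
      rw [add_zero, add_zero] at e0
      rw [cellLength, ← e0, ← e1]
      exact hlen
    · exact ⟨h4, h3 ▸ hj⟩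
    · rw [cellLength_eq (hhalf 0 (.inl rfl) (by simpa using h3))] at hlen
      linarith
    · rw [cellLength_eq (hhalf 1 (.inr rfl) (by simpa using h3))] at hlen
      linarith

end

/-! ### Merging and halving by bumps -/

theorem bumpHomeo_div (q n m : ℕ) (i : ℤ) (h : m + 3 ≤ q * 2 ^ n) {x : ℝ}
    (h0 : i + m + 3 - q * 2 ^ n ≤ x) (h1 : x ≤ i + q * 2 ^ n) :
    bumpHomeo q n i m h (x / 2 ^ n) = (ramp m (x - i) + i) / 2 ^ n := by
  have e : x / 2 ^ n * 2 ^ n = x := div_mul_cancel₀ _ (by positivity)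
  rw [bumpHomeo_apply q n i m h (by rwa [e]) (by rwa [e]), e]

theorem bumpHomeo_inv_div (q n m : ℕ) (i : ℤ) (h : m + 3 ≤ q * 2 ^ n) {x y : ℝ}
    (h0 : i + m + 3 - q * 2 ^ n ≤ x) (h1 : x ≤ i + q * 2 ^ n) (hy : ramp m (x - i) = y - i) :
    (bumpHomeo q n i m h)⁻¹ (y / 2 ^ n) = x / 2 ^ n := by
  have := bumpHomeo_div q n m i h h0 h1
  rw [hy, sub_add_cancel] at this
  rw [← this]
  exact (bumpHomeo q n i m h).symm_apply_apply _

/-- The permutation of cells effected by merging the cells `j, j + 1` and halving `k`, `j < k`. -/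
def mergeRight (j k i : ℤ) : ℤ := if j < i ∧ i < k then i + 1 else if i = k then j + 1 else i

/-- The permutation of cells effected by merging the cells `j, j + 1` and halving `k`, `k < j`. -/
def mergeLeft (j k i : ℤ) : ℤ :=
  if k + 2 ≤ i ∧ i ≤ j + 1 then i - 1 else if i = k + 1 then j + 1 else i

theorem mergeRight_injective {j k : ℤ} (h : j + 2 ≤ k) : Function.Injective (mergeRight j k) := by
  intro a b hab
  unfold mergeRight at hab
  split_ifs at hab <;> omega

theorem mergeLeft_injective {j k : ℤ} (h : k < j) : Function.Injective (mergeLeft j k) := by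
  intro a b hab
  unfold mergeLeft at hab
  split_ifs at hab <;> omega

theorem bump_zero_fixed {q n m : ℕ} {i : ℤ} (h : m + 3 ≤ q * 2 ^ n) (hi : 0 ≤ i)
    (hi' : i + m + 3 ≤ q * 2 ^ n) : bumpHomeo q n i m h 0 = 0 := by
  have h1 : (0 : ℝ) ≤ i := by exact_mod_cast hi
  have h2 : (i : ℝ) + m + 3 ≤ q * 2 ^ n := by exact_mod_cast hi'
  have := bumpHomeo_div q n m i h (x := 0) (by linarith) (by positivity)
  rw [ramp_of_nonpos m (by linarith)] at this
  simpa using this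

/-- A bump sends its first cell onto two cells and its last two cells onto one. Precomposition thus
merges on the left and halves on the right; the inverse bump does the opposite, for the case where
the large cell lies to the left of the siblings. -/
theorem exists_move {q n : ℕ} {g : ℝ ≃ₜ ℝ} (hg : AdaptedGrid q n g) (h0 : g 0 = 0)
    (hgq : g q = q) (hs : (smallCells q n g).Nonempty) :
    ∃ (i : ℤ) (m : ℕ) (h : m + 3 ≤ q * 2 ^ n), ∃ b : ℝ ≃ₜ ℝ,
      (b = bumpHomeo q n i m h ∨ b = (bumpHomeo q n i m h)⁻¹) ∧ b 0 = 0 ∧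
      AdaptedGrid q n (g * b : ℝ ≃ₜ ℝ) ∧
      (smallCells q n (g * b : ℝ ≃ₜ ℝ)).card < (smallCells q n g).card := by
  obtain ⟨j, e, u, hj, hj1, hsib⟩ := exists_siblings hg h0 hgq hs
  obtain ⟨k, hk0, hk1, hk⟩ := exists_big h0 hgq hs
  have hkj : k ≠ j := by
    rintro rfl
    exact lt_asymm hk (mem_smallCells.1 hj).2
  have hkj1 : k ≠ j + 1 := by
    rintro rfl
    exact lt_asymm hk (mem_smallCells.1 hj1).2
  have hj0 := (mem_smallCells.1 hj).1.1
  have hjQ := (mem_smallCells.1 hj1).1.2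
  have c0 : (0 : ℝ) ≤ j := by exact_mod_cast hj0
  have c1 : (0 : ℝ) ≤ k := by exact_mod_cast hk0
  have c2 : (k : ℝ) + 1 ≤ q * 2 ^ n := by exact_mod_cast hk1
  have c3 : (j : ℝ) + 1 + 1 ≤ q * 2 ^ n := by exact_mod_cast hjQ
  rcases lt_or_gt_of_ne hkj with hlt | hlt
  · obtain ⟨m, hm⟩ : ∃ m : ℕ, j = k + 1 + m := ⟨(j - k - 1).toNat, by omega⟩
    have hm' : (j : ℝ) = k + 1 + m := by exact_mod_cast hm
    have h : m + 3 ≤ q * 2 ^ n := by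
      have : (m : ℤ) + 3 ≤ q * 2 ^ n := by omega
      exact_mod_cast this
    refine ⟨k, m, h, (bumpHomeo q n k m h)⁻¹, .inr rfl, ?_, ?_⟩
    · have := bump_zero_fixed h hk0 (by omega)
      conv_lhs => rw [← this]
      exact (bumpHomeo q n k m h).symm_apply_apply 0
    refine adaptedGrid_of_move hg hj hj1 hsib hk0 hk1 hk _ (mergeLeft_injective hlt) ?_
    intro i hi hi'
    have c4 : (0 : ℝ) ≤ i := by exact_mod_cast hi
    have c5 : (i : ℝ) + 1 ≤ q * 2 ^ n := by exact_mod_cast hi'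
    have key : ∀ {x s : ℝ}, 0 ≤ x → x ≤ q * 2 ^ n → ramp m (x - k) = i + s - k →
        (g * (bumpHomeo q n k m h)⁻¹ : ℝ ≃ₜ ℝ) ((i + s) / 2 ^ n) = g (x / 2 ^ n) := by
      intro x s hx hx' hr
      exact congrArg g (bumpHomeo_inv_div q n m k h (by linarith) (by linarith) hr)
    unfold mergeLeft
    rcases lt_trichotomy i k with hik | rfl | hik
    · have c6 : (i : ℝ) + 1 ≤ k := by exact_mod_cast hik
      rw [if_neg (by omega), if_neg (by omega)]
      exact .inl ⟨hi, hi', by omega, .inl fun s hs hs' =>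
        key (by linarith) (by linarith) (ramp_of_nonpos m (by linarith))⟩
    · refine .inr (.inl fun s hs hs' => key (by linarith) (by linarith) ?_)
      rw [ramp_of_le_one m (by linarith) (by linarith)]
      ring
    rcases eq_or_ne i (k + 1) with rfl | hik1
    · refine .inr (.inr fun s hs hs' => key (by linarith) (by linarith) ?_)
      rw [ramp_of_le_one m (by linarith) (by linarith)]
      push_cast
      ring
    have c6 : (k : ℝ) + 2 ≤ i := by
      have : k + 2 ≤ i := by omega
      exact_mod_cast this
    rcases lt_trichotomy i (j + 1) with hij | rfl | hij
    · have c7 : (i : ℝ) + 1 ≤ j + 1 := by exact_mod_cast hij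
      rw [if_pos (by omega)]
      refine .inl ⟨by omega, by omega, by omega, .inl fun s hs hs' => ?_⟩
      push_cast
      refine key (by linarith) (by linarith) ?_
      rw [ramp_of_mid m (by linarith) (by linarith)]
      ring
    · rw [if_pos (by omega)]
      refine .inl ⟨by omega, by omega, by omega, .inr ⟨by omega, fun s hs hs' => ?_⟩⟩
      refine key (by linarith) (by linarith) ?_
      rw [ramp_of_end m (by linarith) (by linarith), hm']
      push_cast
      rw [hm']
      ring
    · have c7 : (j : ℝ) + 1 + 1 ≤ i := by exact_mod_cast hij
      rw [if_neg (by omega), if_neg (by omega)]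
      exact .inl ⟨hi, hi', by omega, .inl fun s hs hs' =>
        key (by linarith) (by linarith) (ramp_of_ge m (by linarith))⟩
  · obtain ⟨m, hm⟩ : ∃ m : ℕ, k = j + 2 + m := ⟨(k - j - 2).toNat, by omega⟩
    have hm' : (k : ℝ) = j + 2 + m := by exact_mod_cast hm
    have c9 : (0 : ℝ) ≤ m := by positivity
    have h : m + 3 ≤ q * 2 ^ n := by
      have : (m : ℤ) + 3 ≤ q * 2 ^ n := by omega
      exact_mod_cast this
    refine ⟨j, m, h, bumpHomeo q n j m h, .inl rfl, bump_zero_fixed h hj0 (by omega), ?_⟩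
    refine adaptedGrid_of_move hg hj hj1 hsib hk0 hk1 hk _
      (mergeRight_injective (j := j) (k := k) (by omega)) ?_
    intro i hi hi'
    have c4 : (0 : ℝ) ≤ i := by exact_mod_cast hi
    have c5 : (i : ℝ) + 1 ≤ q * 2 ^ n := by exact_mod_cast hi'
    have key : ∀ {x s : ℝ}, 0 ≤ s → s ≤ 1 → ramp m (i + s - j) = x - j →
        (g * bumpHomeo q n j m h : ℝ ≃ₜ ℝ) ((i + s) / 2 ^ n) = g (x / 2 ^ n) := by
      intro x s hs hs' hr
      have := bumpHomeo_div q n m j h (x := i + s) (by linarith) (by linarith)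
      rw [hr, sub_add_cancel] at this
      exact congrArg g this
    unfold mergeRight
    rcases lt_trichotomy i j with hij | rfl | hij
    · have c6 : (i : ℝ) + 1 ≤ j := by exact_mod_cast hij
      rw [if_neg (by omega), if_neg (by omega)]
      exact .inl ⟨hi, hi', by omega, .inl fun s hs hs' =>
        key hs hs' (ramp_of_nonpos m (by linarith))⟩
    · rw [if_neg (by omega), if_neg (by omega)]
      refine .inl ⟨hi, hi', by omega, .inr ⟨rfl, fun s hs hs' => key hs hs' ?_⟩⟩
      rw [ramp_of_le_one m (by linarith) (by linarith)]
      ring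
    have c6 : (j : ℝ) + 1 ≤ i := by exact_mod_cast hij
    rcases lt_trichotomy i k with hik | rfl | hik
    · rcases eq_or_ne (i + 1) k with hik1 | hik1
      · have c7 : (i : ℝ) + 1 = k := by exact_mod_cast hik1
        refine .inr (.inl fun s hs hs' => key hs hs' ?_)
        rw [ramp_of_end m (by linarith) (by linarith)]
        linarith
      · have c7 : (i : ℝ) + 2 ≤ k := by
          have : i + 2 ≤ k := by omega
          exact_mod_cast this
        rw [if_pos (by omega)]
        refine .inl ⟨by omega, by omega, by omega, .inl fun s hs hs' => ?_⟩
        push_cast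
        refine key hs hs' ?_
        rw [ramp_of_mid m (by linarith) (by linarith)]
        ring
    · refine .inr (.inr fun s hs hs' => key hs hs' ?_)
      rw [ramp_of_end m (by linarith) (by linarith)]
      linarith
    · have c7 : (k : ℝ) + 1 ≤ i := by exact_mod_cast hik
      rw [if_neg (by omega), if_neg (by omega)]
      exact .inl ⟨hi, hi', by omega, .inl fun s hs hs' =>
        key hs hs' (ramp_of_ge m (by linarith))⟩

theorem Hp.apply_self {q : ℕ} {g : ℝ ≃ₜ ℝ} (hg : g ∈ Hp q) (h0 : g 0 = 0) : g q = q := by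
  simpa [h0] using hg.2 0

theorem eq_one_of_no_small {q n : ℕ} (hq : 1 ≤ q) {g : ℝ ≃ₜ ℝ} (hg : g ∈ Hp q)
    (ha : AdaptedGrid q n g) (h0 : g 0 = 0) (hs : smallCells q n g = ∅) : g = 1 := by
  have hv := fun j : ℤ => vertex_eq_of_no_small (j := j) h0 (Hp.apply_self hg h0) hs
  refine Hp.ext_mul_two_pow hq hg (one_mem _) n 0 fun t ht ht' => ?_
  rw [zero_add] at ht'
  change g t * 2 ^ n = t * 2 ^ n
  rcases ht'.eq_or_lt with h | h
  · rw [mul_right_cancel₀ (by positivity) h, Hp.apply_self hg h0]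
  have h1 : 0 ≤ ⌊t * 2 ^ n⌋ := Int.floor_nonneg.2 ht
  have h2 : ⌊t * 2 ^ n⌋ < q * 2 ^ n := by
    rw [Int.floor_lt]
    exact_mod_cast h
  obtain ⟨k, u, hk⟩ := ha _ h1 h2
  have v0 := hv _ h1 h2.le
  have v1 := hv (⌊t * 2 ^ n⌋ + 1) (by omega) (by omega)
  have s0 := hk 0 le_rfl zero_le_one
  have s1 := hk 1 zero_le_one le_rfl
  have s2 := hk (t * 2 ^ n - ⌊t * 2 ^ n⌋) (by linarith [Int.floor_le (t * 2 ^ n)])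
    (by linarith [Int.lt_floor_add_one (t * 2 ^ n)])
  rw [add_sub_cancel, mul_div_cancel_right₀ _ (by positivity)] at s2
  push_cast at v1
  rw [add_zero, v0, add_zero] at s0
  rw [v1] at s1
  have hp : (0 : ℝ) < 2 ^ n := by positivity
  rw [div_eq_iff hp.ne'] at s0 s1
  have s3 : (2 : ℝ) ^ k * 2 ^ n = 1 := by linarith
  rw [s2, mul_assoc, s3, mul_one]
  rw [mul_assoc, s3, mul_one] at s0
  linarith

/-- If a normal subgroup contains the bumps of scale `2 ^ (-n)`, it contains every element of `H_q`
which fixes `0` and is adapted to the grid of that scale. -/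
theorem mem_of_adaptedGrid {N : Subgroup H} {q n : ℕ} (hq : 1 ≤ q)
    (hb : ∀ i m h, bump q n i m h ∈ N) (g : H) (hg : (g : ℝ ≃ₜ ℝ) ∈ Hp q)
    (h0 : (g : ℝ ≃ₜ ℝ) 0 = 0) (ha : AdaptedGrid q n (g : ℝ ≃ₜ ℝ)) : g ∈ N := by
  induction hc : (smallCells q n (g : ℝ ≃ₜ ℝ)).card using Nat.strong_induction_on generalizing g with
  | _ c ih =>
    rcases (smallCells q n (g : ℝ ≃ₜ ℝ)).eq_empty_or_nonempty with hs | hs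
    · have : g = 1 := Subtype.ext (eq_one_of_no_small hq hg ha h0 hs)
      rw [this]
      exact one_mem N
    · obtain ⟨i, m, h, b, hbm, hb0, ha', hc'⟩ := exists_move ha h0 (Hp.apply_self hg h0) hs
      obtain ⟨B, hBN, hBq, rfl⟩ : ∃ B : H, B ∈ N ∧ (B : ℝ ≃ₜ ℝ) ∈ Hp q ∧ (B : ℝ ≃ₜ ℝ) = b := by
        rcases hbm with rfl | rfl
        · exact ⟨bump q n i m h, hb i m h, bumpHomeo_mem_Hp q n i m h, rfl⟩
        · exact ⟨(bump q n i m h)⁻¹, inv_mem (hb i m h), inv_mem (bumpHomeo_mem_Hp q n i m h), rfl⟩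
      have := ih _ (hc ▸ hc') (g * B) (mul_mem hg hBq) (by
        change (g : ℝ ≃ₜ ℝ) ((B : ℝ ≃ₜ ℝ) 0) = 0
        rw [hb0, h0]) ha' rfl
      exact (Subgroup.mul_mem_cancel_right N hBN).1 this

/-! ### Every element of `H_q` is adapted to fine grids -/

/-- The derivative is locally constant on a connected open interval, hence constant; continuity
extends the formula to the endpoints, and monotonicity excludes negative slopes. -/
theorem exists_affine_of_affineNear {f : ℝ → ℝ} (hf : Continuous f) (hmono : StrictMono f) {a b : ℝ}
    (hab : a < b) (h : ∀ x ∈ Set.Ioo a b, AffineNear f x) :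
    ∃ k : ℤ, ∀ t ∈ Set.Icc a b, f t = f a + 2 ^ k * (t - a) := by
  have hder : ∀ x ∈ Set.Ioo a b, ∃ c : ℝ, HasDerivAt f c x ∧ deriv f =ᶠ[𝓝 x] fun _ => c := by
    intro x hx
    obtain ⟨k, c, d, -, hcd⟩ := h x hx
    have h1 : ∀ {y : ℝ}, (∀ᶠ t in 𝓝 y, f t = c * t + d) → HasDerivAt f c y := by
      intro y hy
      have h2 : HasDerivAt (fun t : ℝ => c * t + d) c y := by
        simpa using ((hasDerivAt_id y).const_mul c).add_const d
      exact h2.congr_of_eventuallyEq hy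
    refine ⟨c, h1 hcd, ?_⟩
    filter_upwards [hcd.eventually_nhds] with y hy
    exact (h1 hy).deriv
  have hdiff : DifferentiableOn ℝ (deriv f) (Set.Ioo a b) := by
    intro x hx
    obtain ⟨c, -, hc⟩ := hder x hx
    exact ((differentiableAt_const c).congr_of_eventuallyEq hc).differentiableWithinAt
  have hdd : Set.EqOn (deriv (deriv f)) 0 (Set.Ioo a b) := by
    intro x hx
    obtain ⟨c, -, hc⟩ := hder x hx
    rw [hc.deriv_eq]
    simp
  obtain ⟨x₀, hx₀⟩ := Set.nonempty_Ioo.2 hab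
  obtain ⟨k, c, d, hk, hcd⟩ := h x₀ hx₀
  have hc : deriv f x₀ = c := by
    have h2 : HasDerivAt (fun t : ℝ => c * t + d) c x₀ := by
      simpa using ((hasDerivAt_id x₀).const_mul c).add_const d
    exact (h2.congr_of_eventuallyEq hcd).deriv
  have hderiv : ∀ x ∈ Set.Ioo a b, HasDerivAt f c x := by
    intro x hx
    obtain ⟨c', hc', -⟩ := hder x hx
    have := isOpen_Ioo.is_const_of_deriv_eq_zero isPreconnected_Ioo hdiff hdd hx hx₀
    rw [hc, hc'.deriv] at this
    rwa [this] at hc'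
  have hconst : ∀ x ∈ Set.Ioo a b, HasDerivAt (fun t => f t - c * t) 0 x := by
    intro x hx
    have h1 := (hderiv x hx).fun_sub ((hasDerivAt_id x).const_mul c)
    rwa [mul_one, sub_self] at h1
  have hioo : Set.EqOn (fun t => f t - c * t) (fun _ => f x₀ - c * x₀) (Set.Ioo a b) := fun x hx =>
    isOpen_Ioo.is_const_of_deriv_eq_zero isPreconnected_Ioo
      (fun y hy => (hconst y hy).differentiableAt.differentiableWithinAt)
      (fun y hy => (hconst y hy).deriv) hx hx₀
  have hicc : Set.EqOn (fun t => f t - c * t) (fun _ => f x₀ - c * x₀) (Set.Icc a b) :=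
    hioo.of_subset_closure (by fun_prop) (by fun_prop) Set.Ioo_subset_Icc_self
      (by rw [closure_Ioo hab.ne])
  have hval : ∀ t ∈ Set.Icc a b, f t = f a + c * (t - a) := by
    intro t ht
    have h1 := hicc ht
    have h2 := hicc (Set.left_mem_Icc.2 hab.le)
    simp only at h1 h2
    linarith
  have hpos : 0 < c := by
    have h1 := hval b (Set.right_mem_Icc.2 hab.le)
    have h2 := hmono hab
    exact (pos_iff_pos_of_mul_pos (by linarith : 0 < c * (b - a))).2 (sub_pos.2 hab)
  rw [abs_of_pos hpos] at hk
  exact ⟨k, hk ▸ hval⟩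

theorem eventually_mul_two_pow_eq_int {x : ℝ} (hx : x ∈ dyadic) :
    ∀ᶠ n : ℕ in Filter.atTop, ∃ z : ℤ, x * 2 ^ n = z := by
  obtain ⟨m, k, rfl⟩ := hx
  filter_upwards [Filter.eventually_ge_atTop k] with n hn
  obtain ⟨d, rfl⟩ := Nat.exists_eq_add_of_le hn
  refine ⟨m * 2 ^ d, ?_⟩
  push_cast
  rw [pow_add]
  field_simp

/-- Every element of `H_q` is adapted to all sufficiently fine dyadic grids. -/
theorem eventually_adaptedGrid {q : ℕ} {g : ℝ ≃ₜ ℝ} (hg : g ∈ Hp q) :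
    ∀ᶠ n : ℕ in Filter.atTop, AdaptedGrid q n g := by
  obtain ⟨⟨⟨hgd, B, hBd, hBf, hB⟩, hmono⟩, -⟩ := hg
  -- A first grid fine enough to contain the finitely many breakpoints in `[0, q]`.
  obtain ⟨n₁, hn₁⟩ := ((Filter.eventually_all_finite (hBf (Set.Icc 0 q) isCompact_Icc)).2
    fun x hx => eventually_mul_two_pow_eq_int (hBd hx.1)).exists
  have hp₁ : (0 : ℝ) < 2 ^ n₁ := by positivity
  have hcell : ∀ j : ℤ, ∃ k : ℤ, 0 ≤ j → j < q * 2 ^ n₁ → ∀ s : ℝ, 0 ≤ s → s ≤ 1 →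
      g ((j + s) / 2 ^ n₁) = g (j / 2 ^ n₁) + 2 ^ k * (s / 2 ^ n₁) := by
    intro j
    by_cases hj : 0 ≤ j ∧ j < q * 2 ^ n₁
    · have c0 : (0 : ℝ) ≤ j := by exact_mod_cast hj.1
      have c1 : (j : ℝ) + 1 ≤ q * 2 ^ n₁ := by exact_mod_cast hj.2
      obtain ⟨k, hk⟩ := exists_affine_of_affineNear g.continuous hmono
        (a := j / 2 ^ n₁) (b := (j + 1) / 2 ^ n₁) (by gcongr; linarith) (fun x hx => by
          have h0 := (div_lt_iff₀ hp₁).1 hx.1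
          have h1 := (lt_div_iff₀ hp₁).1 hx.2
          refine hB x fun hxB => ?_
          obtain ⟨z, hz⟩ := hn₁ x ⟨hxB, (by positivity : (0 : ℝ) ≤ j / 2 ^ n₁).trans hx.1.le,
            hx.2.le.trans ((div_le_iff₀ hp₁).2 c1)⟩
          rw [hz] at h0 h1
          have h2 : j < z := by exact_mod_cast h0
          have h3 : z < j + 1 := by exact_mod_cast h1
          omega)
      refine ⟨k, fun _ _ s hs hs' => ?_⟩
      rw [hk _ ⟨by gcongr; linarith, by gcongr⟩]
      ring
    · exact ⟨0, fun h0 h1 => absurd ⟨h0, h1⟩ hj⟩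
  choose k hk using hcell
  -- Refining further makes the image of each old vertex an integer multiple of the new image length
  -- `2 ^ (k j - n)`.
  have hfin := (Filter.eventually_all_finite (Set.finite_Ico (0 : ℤ) (q * 2 ^ n₁))).2
    fun j _ => eventually_mul_two_pow_eq_int
      (dyadic_mul ((hgd _).2 (dyadic_int_div_pow j n₁)) (dyadic_zpow (-k j)))
  filter_upwards [hfin, Filter.eventually_ge_atTop n₁] with n hn hle
  obtain ⟨d, rfl⟩ := Nat.exists_eq_add_of_le hle
  intro i hi hi'
  have hd : (0 : ℤ) < 2 ^ d := by positivity
  have hj0 : 0 ≤ i / 2 ^ d := Int.ediv_nonneg hi hd.le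
  have hj1 : i / 2 ^ d < q * 2 ^ n₁ := by
    rw [Int.ediv_lt_iff_lt_mul hd]
    rwa [pow_add, ← mul_assoc] at hi'
  have hr0 := Int.emod_nonneg i hd.ne'
  have hr1 := Int.emod_lt_of_pos i hd
  have hri := Int.mul_ediv_add_emod i (2 ^ d)
  generalize i / 2 ^ d = j at *
  generalize i % 2 ^ d = r at *
  obtain ⟨z, hz⟩ := hn j ⟨hj0, hj1⟩
  have hv : g (j / 2 ^ n₁) = z * 2 ^ k j / 2 ^ (n₁ + d) := by
    rw [← hz, zpow_neg]
    field_simp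
  refine ⟨k j - (n₁ + d : ℕ), z + r, fun s hs hs' => ?_⟩
  have c0 : (0 : ℝ) ≤ r := by exact_mod_cast hr0
  have c1 : (r : ℝ) + 1 ≤ 2 ^ d := by exact_mod_cast hr1
  have e : ((i : ℝ) + s) / 2 ^ (n₁ + d) = (j + (r + s) / 2 ^ d) / 2 ^ n₁ := by
    rw [← hri, pow_add]
    push_cast
    field_simp
    ring
  rw [e, hk j hj0 hj1 _ (by positivity) (by rw [div_le_one (by positivity)]; linarith), hv,
    zpow_sub₀ (by norm_num), zpow_natCast, pow_add]
  push_cast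
  field_simp
  ring

/-! ### Moving the origin, and conclusion -/

theorem exists_dyadic_between {a b : ℝ} (h : a < b) : ∃ x ∈ dyadic, a < x ∧ x < b := by
  obtain ⟨n, hn⟩ := exists_pow_lt_of_lt_one (sub_pos.2 h) (by norm_num : (1 / 2 : ℝ) < 1)
  have hp : (0 : ℝ) < 2 ^ n := by positivity
  have h1 : 1 < (b - a) * 2 ^ n := by
    rwa [one_div, inv_pow, inv_lt_iff_one_lt_mul₀ hp] at hn
  refine ⟨_, dyadic_int_div_pow (⌊a * 2 ^ n⌋ + 1) n, ?_, ?_⟩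
  · rw [lt_div_iff₀ hp]
    push_cast
    exact Int.lt_floor_add_one _
  · rw [div_lt_iff₀ hp]
    push_cast
    linarith [Int.floor_le (a * 2 ^ n)]

theorem exists_dyadic_apply_ne {f : ℝ ≃ₜ ℝ} (hf : f ≠ 1) : ∃ x ∈ dyadic, f x ≠ x := by
  by_contra! hcon
  apply hf
  have hd : Dense dyadic := dense_of_exists_between fun _ _ h => by
    obtain ⟨x, hx, h1, h2⟩ := exists_dyadic_between h
    exact ⟨x, hx, h1, h2⟩
  ext x
  exact congrFun (f.continuous.ext_on hd continuous_id hcon) x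

/-- Based at `-1 / 2 ^ n`, the bump is translation by one cell on `[0, r / 2 ^ n]`. -/
theorem bumpHomeo_pow_apply_zero {q n r : ℕ} (h : r + 3 ≤ q * 2 ^ n) {k : ℕ} (hk : k ≤ r) :
    (bumpHomeo q n (-1) r h ^ k) 0 = k / 2 ^ n := by
  induction k with
  | zero => simp
  | succ k ih =>
    have c0 : (r : ℝ) + 3 ≤ q * 2 ^ n := by exact_mod_cast h
    have c1 : (k : ℝ) + 1 ≤ r := by exact_mod_cast hk
    have c2 : (0 : ℝ) ≤ k := by positivity
    rw [pow_succ']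
    change bumpHomeo q n (-1) r h ((bumpHomeo q n (-1) r h ^ k) 0) = _
    rw [ih (by omega), bumpHomeo_div q n r (-1) h (by push_cast; linarith) (by push_cast; linarith),
      ramp_of_mid r (by push_cast; linarith) (by push_cast; linarith)]
    push_cast
    ring

section

variable {N : Subgroup H} {q : ℕ}

theorem eventually_bump_mem [N.Normal] (hq : 1 ≤ q) {η : ℝ} (hη : 0 < η) (hN : CommuteNear N q η) :
    ∀ᶠ n : ℕ in Filter.atTop, ∀ i m h, bump q n i m h ∈ N := by
  have ht : Filter.Tendsto (fun n : ℕ => (2 : ℝ) ^ n) Filter.atTop Filter.atTop :=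
    tendsto_pow_atTop_atTop_of_one_lt (by norm_num)
  have h1 := (ht.const_mul_atTop hη).eventually_ge_atTop 6
  have h2 := (ht.const_mul_atTop (by exact_mod_cast hq : (0 : ℝ) < q)).eventually_ge_atTop 6
  obtain ⟨n₀, hn₀⟩ := Filter.eventually_atTop.1 (h1.and h2)
  filter_upwards [Filter.eventually_ge_atTop (n₀ + 1)] with n hn
  obtain ⟨d, rfl⟩ := Nat.exists_eq_add_of_le hn
  intro i m
  have h3 := hn₀ (n₀ + d) (by omega)
  have h4 : n₀ + 1 + d = n₀ + d + 1 := by omega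
  rw [h4]
  exact bump_mem hN (by exact_mod_cast h3.2) h3.1 i m

theorem mem_of_apply_zero_eq (hq : 1 ≤ q)
    (hb : ∀ᶠ n : ℕ in Filter.atTop, ∀ i m h, bump q n i m h ∈ N) {g : H}
    (hg : (g : ℝ ≃ₜ ℝ) ∈ Hp q) (h0 : (g : ℝ ≃ₜ ℝ) 0 = 0) : g ∈ N := by
  obtain ⟨n, hn, hn'⟩ := (hb.and (eventually_adaptedGrid hg)).exists
  exact mem_of_adaptedGrid hq hn g hg h0 hn'

theorem mem_of_apply_zero_pos (hq : 1 ≤ q)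
    (hb : ∀ᶠ n : ℕ in Filter.atTop, ∀ i m h, bump q n i m h ∈ N) {g : H}
    (hg : (g : ℝ ≃ₜ ℝ) ∈ Hp q) (h0 : 0 < (g : ℝ ≃ₜ ℝ) 0) (h1 : (g : ℝ ≃ₜ ℝ) 0 + 2 ≤ q) :
    g ∈ N := by
  have hd : (g : ℝ ≃ₜ ℝ) 0 ∈ dyadic := (hg.1.1.1 0).2 (by simpa using dyadic_intCast 0)
  obtain ⟨n, hn, ⟨z, hz⟩, hn1⟩ := (hb.and ((eventually_mul_two_pow_eq_int hd).and
    (Filter.eventually_ge_atTop 1))).exists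
  have hp : (0 : ℝ) < 2 ^ n := by positivity
  have hz0 : 0 ≤ z := by
    have : (0 : ℝ) ≤ z := hz ▸ by positivity
    exact_mod_cast this
  lift z to ℕ using hz0
  rw [Int.cast_natCast] at hz
  -- The margin `2` in `h1` leaves at least four cells once `n ≥ 1`, room for the three extra cells
  -- of the bump.
  have h : z + 3 ≤ q * 2 ^ n := by
    have h2 : (2 : ℝ) ≤ 2 ^ n := by
      simpa using pow_le_pow_right₀ (by norm_num : (1 : ℝ) ≤ 2) hn1
    have h3 := mul_le_mul_of_nonneg_right h1 hp.le
    have h4 : (z : ℝ) + 3 ≤ q * 2 ^ n := by linarith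
    exact_mod_cast h4
  have hbN : bump q n (-1) z h ^ z ∈ N := pow_mem (hn _ _ _) z
  have hbq : ((bump q n (-1) z h ^ z : H) : ℝ ≃ₜ ℝ) ∈ Hp q := by
    rw [Subgroup.coe_pow]
    exact pow_mem (bumpHomeo_mem_Hp q n (-1) z h) z
  have hb0 : ((bump q n (-1) z h ^ z : H) : ℝ ≃ₜ ℝ) 0 = (g : ℝ ≃ₜ ℝ) 0 := by
    rw [Subgroup.coe_pow]
    exact (bumpHomeo_pow_apply_zero h le_rfl).trans (by rw [← hz]; field_simp)
  generalize bump q n (-1) z h ^ z = b at hbN hbq hb0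
  have : b⁻¹ * g ∈ N := mem_of_apply_zero_eq hq hb (mul_mem (inv_mem hbq) hg) (by
    change (b : ℝ ≃ₜ ℝ).symm ((g : ℝ ≃ₜ ℝ) 0) = 0
    rw [← hb0, Homeomorph.symm_apply_apply])
  exact (Subgroup.mul_mem_cancel_left N (inv_mem hbN)).1 this

end

/-- By density some dyadic point is moved, and a dyadic translation carries it to `0`. -/
theorem exists_mem_apply_zero_ne {N : Subgroup H} [N.Normal] (hN : N ≠ ⊥) :
    ∃ f ∈ N, (f : ℝ ≃ₜ ℝ) 0 ≠ 0 := by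
  obtain ⟨f, hfN, hf⟩ := N.bot_or_exists_ne_one.resolve_left hN
  obtain ⟨x, hx, hfx⟩ := exists_dyadic_apply_ne (f := (f : H)) fun h => hf (Subtype.ext h)
  have hs : shift (-x) ∈ H := Hp_le_H le_rfl (shift_mem_Hp (dyadic_neg hx) 1)
  refine ⟨_, Subgroup.Normal.conj_mem ‹N.Normal› _ hfN ⟨_, hs⟩, ?_⟩
  change shift (-x) (((f : H) : ℝ ≃ₜ ℝ) ((shift (-x))⁻¹ 0)) ≠ 0
  rw [shift_inv_apply, shift_apply, zero_sub, neg_neg, ← sub_eq_add_neg]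
  exact sub_ne_zero.2 hfx

theorem eq_top_of_normal {N : Subgroup H} [N.Normal] (hN : N ≠ ⊥) : N = ⊤ := by
  obtain ⟨f, hfN, hf0⟩ := exists_mem_apply_zero_ne hN
  refine (Subgroup.eq_top_iff' N).2 fun g => ?_
  obtain ⟨a, ha, hfa⟩ := f.2
  obtain ⟨b, hb, hgb⟩ := g.2
  -- The multiple `a * b * r` is a common period exceeding `|f 0|`, and exceeding `g 0` and `g⁻¹ 0`
  -- by at least `2`.
  obtain ⟨r, hr⟩ := exists_nat_gt (|(f : ℝ ≃ₜ ℝ) 0| + |(g : ℝ ≃ₜ ℝ) 0| + |(g⁻¹ : H).1 0| + 2)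
  have hab : 1 ≤ a * b := Nat.mul_pos ha hb
  have hqr : (r : ℝ) ≤ (a * b * r : ℕ) := by exact_mod_cast Nat.le_mul_of_pos_left r hab
  have hfq : (f : ℝ ≃ₜ ℝ) ∈ Hp (a * b * r) := Hp_le_mul _ _ (Hp_le_mul _ _ hfa)
  have hgq : (g : ℝ ≃ₜ ℝ) ∈ Hp (a * b * r) := by
    rw [mul_comm a b]
    exact Hp_le_mul _ _ (Hp_le_mul _ _ hgb)
  generalize a * b * r = q at *
  have n1 := abs_nonneg ((f : ℝ ≃ₜ ℝ) 0)
  have n2 := le_abs_self ((g : ℝ ≃ₜ ℝ) 0)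
  have n3 := le_abs_self ((g⁻¹ : H).1 0)
  have n4 := abs_nonneg ((g : ℝ ≃ₜ ℝ) 0)
  have n5 := abs_nonneg ((g⁻¹ : H).1 0)
  have hq : 1 ≤ q := by
    have : (1 : ℝ) ≤ q := by linarith
    exact_mod_cast this
  obtain ⟨η, hη, hcomm⟩ := exists_commuteNear N hfN hfq hf0 (by linarith)
  have hbump := eventually_bump_mem hq hη hcomm
  rcases lt_trichotomy ((g : ℝ ≃ₜ ℝ) 0) 0 with h | h | h
  · have hinv : 0 < (g⁻¹ : H).1 0 := by
      have hm : StrictMono (g⁻¹ : H).1 := (inv_mem hgq).1.2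
      have h1 : (g⁻¹ : H).1 ((g : ℝ ≃ₜ ℝ) 0) = 0 := (g : ℝ ≃ₜ ℝ).symm_apply_apply 0
      have h2 := hm h
      rwa [h1] at h2
    exact (inv_mem_iff (H := N)).1 (mem_of_apply_zero_pos hq hbump (inv_mem hgq) hinv (by linarith))
  · exact mem_of_apply_zero_eq hq hbump hgq h
  · exact mem_of_apply_zero_pos hq hbump hgq h (by linarith)

end DyadicPL

theorem theorem2 : IsSimpleGroup DyadicPL.H where
  exists_pair_ne := by
    refine ⟨⟨DyadicPL.shift 1, DyadicPL.Hp_le_H le_rfl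
      (DyadicPL.shift_mem_Hp (by simpa using DyadicPL.dyadic_intCast 1) 1)⟩, 1, fun h => ?_⟩
    have : DyadicPL.shift 1 0 = 0 := DFunLike.congr_fun (congrArg Subtype.val h) 0
    simp at this
  eq_bot_or_eq_top_of_normal N hN := by
    by_cases h : N = ⊥
    · exact .inl h
    · exact .inr (DyadicPL.eq_top_of_normal h)
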